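/- Let $n,p$ be integers with $1\le p\le n-2$, and let $\mathbb{H}^{2n+p}$ denote the hyperbolic space of dimension $2n+p$ and constant sectional curvature $-1$. (a) Let $(M^{2n},\langle\,,\rangle,J)$ be a Kaehler manifold of real dimension $2n$ (a smooth Riemannian manifold with a smooth orthogonal almost complex structure $J$ that is parallel for the Levi-Civita connection), and let $f\colon M^{2n}\to\mathbb{H}^{2n+p}$ be a smooth isometric immersion. Then at every point $x\in M^{2n}$ there is a complex (that is, $J$-invariant) vector subspace $V^{2\ell}\subset T_xM$ of real dimension $2\ell$, with $\ell\ge n-p+1$, such that for every $S\in V^{2\ell}$ the sectional curvature of $M^{2n}$ satisfies $K(S,JS)\le 0$ (if $S\ne 0$) and the Ricci curvature satisfies $\mathrm{Ric}(S)\le 0$, where $\mathrm{Ric}(S)$ is the trace of $X\mapsto R(X,S)S$. (b) The estimate is sharp, for each of the two curvatures: for all such $n$ and $p$ there are a connected Kaehler manifold $M^{2n}$, a smooth isometric immersion $f\colon M^{2n}\to\mathbb{H}^{2n+p}$ and a point $x\in M^{2n}$ such that every complex vector subspace $V^{2\ell}\subset T_xM$ on which $K(S,JS)\le 0$ for all $0\neq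 S\in V^{2\ell}$ has $\ell\le n-p+1$, and every complex vector subspace $V^{2\ell}\subset T_xM$ on which $\mathrm{Ric}(S)\le 0$ for all $S\in V^{2\ell}$ has $\ell\le n-p+1$. -/

import Mathlib

open scoped Manifold ContDiff

set_option maxSynthPendingDepth 3

noncomputable section

namespace KaehlerHyperbolic

/-! ### Riemannian geometry of a metric on an open set of a vector space -/

section LocalGeometry

variable {E : Type*} [NormedAddCommGroup E] [NormedSpace ℝ E]

/-- The lowered Christoffel symbols of a metric `G`:
`(u, v, w) ↦ (1/2) (∂_u G(v, w) + ∂_v G(u, w) - ∂_w G(u, v))`. -/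
def koszul (G : E → E →L[ℝ] E →L[ℝ] ℝ) (y : E) : E →L[ℝ] E →L[ℝ] E →L[ℝ] ℝ :=
  let D : E →L[ℝ] E →L[ℝ] E →L[ℝ] ℝ := fderiv ℝ G y
  let T : E →L[ℝ] E →L[ℝ] E →L[ℝ] ℝ :=
    ((ContinuousLinearMap.flipₗᵢ ℝ E E ℝ).toContinuousLinearEquiv :
      (E →L[ℝ] E →L[ℝ] ℝ) →L[ℝ] (E →L[ℝ] E →L[ℝ] ℝ)) ∘L D.flip
  (1 / 2 : ℝ) • (D + D.flip - T)

theorem koszul_apply (G : E → E →L[ℝ] E →L[ℝ] ℝ) (y u v w : E) :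
    koszul G y u v w = (1 / 2 : ℝ) *
      (fderiv ℝ G y u v w + fderiv ℝ G y v u w - fderiv ℝ G y w u v) := rfl

/-- The Christoffel symbols `Γ_y(u, v) = (∇_u v)(y)` (for constant `u`, `v`) of the Levi-Civita
connection: the vector with `G_y(Γ_y(u, v), w) = koszul G y u v w` for all `w`. -/
def christoffel (G : E → E →L[ℝ] E →L[ℝ] ℝ) (y : E) : E →L[ℝ] E →L[ℝ] E :=
  (ContinuousLinearMap.compL ℝ E (E →L[ℝ] ℝ) E (G y).inverse) ∘L koszul G y

theorem christoffel_apply (G : E → E →L[ℝ] E →L[ℝ] ℝ) (y u v : E) :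
    christoffel G y u v = (G y).inverse (koszul G y u v) := rfl

/-- The curvature `R(u, v) w = ∇_u ∇_v w - ∇_v ∇_u w - ∇_[u, v] w` of the metric `G` at `y`. -/
def localCurvature (G : E → E →L[ℝ] E →L[ℝ] ℝ) (y u v w : E) : E :=
  fderiv ℝ (christoffel G) y u v w - fderiv ℝ (christoffel G) y v u w
    + christoffel G y u (christoffel G y v w) - christoffel G y v (christoffel G y u w)

theorem localCurvature_add (G : E → E →L[ℝ] E →L[ℝ] ℝ) (y u u' v w : E) :
    localCurvature G y (u + u') v w = localCurvature G y u v w + localCurvature G y u' v w := by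
  simp only [localCurvature, map_add, add_apply]
  abel

theorem localCurvature_smul (G : E → E →L[ℝ] E →L[ℝ] ℝ) (c : ℝ) (y u v w : E) :
    localCurvature G y (c • u) v w = c • localCurvature G y u v w := by
  simp only [localCurvature, map_smul, smul_apply, smul_add, smul_sub]

/-- The covariant derivative `(∇_u J) v` at `y` of a field `J` of endomorphisms. -/
def localCovDerivEnd (G : E → E →L[ℝ] E →L[ℝ] ℝ) (J : E → E →L[ℝ] E) (y u v : E) : E :=
  fderiv ℝ J y u v + christoffel G y u (J y v) - J y (christoffel G y u v)

end LocalGeometry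

/-! ### Riemannian geometry of a manifold -/

/-- The model space of a manifold of real dimension `2 * n`. -/
abbrev Model (n : ℕ) : Type := EuclideanSpace ℝ (Fin (2 * n))

section Manifold

variable {n : ℕ} {M : Type*} [TopologicalSpace M] [ChartedSpace (Model n) M]
  [IsManifold 𝓘(ℝ, Model n) ∞ M]

variable (n M) in
/-- Smooth Riemannian metrics on a manifold `M` of dimension `2 * n`. -/
abbrev RiemannianMetric : Type _ :=
  Bundle.ContMDiffRiemannianMetric 𝓘(ℝ, Model n) ∞ (Model n)
    (fun x : M ↦ TangentSpace 𝓘(ℝ, Model n) x)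

/-- The differential at `y` of the inverse of the preferred chart around `x₀`. -/
def chartSymmDeriv (x₀ : M) (y : Model n) : Model n →L[ℝ]
    TangentSpace 𝓘(ℝ, Model n) ((extChartAt 𝓘(ℝ, Model n) x₀).symm y) :=
  mfderiv 𝓘(ℝ, Model n) 𝓘(ℝ, Model n) (extChartAt 𝓘(ℝ, Model n) x₀).symm y

/-- The differential, at the point with coordinates `y`, of the preferred chart around `x₀`. -/
def chartDeriv (x₀ : M) (y : Model n) :
    TangentSpace 𝓘(ℝ, Model n) ((extChartAt 𝓘(ℝ, Model n) x₀).symm y) →L[ℝ] Model n :=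
  mfderiv 𝓘(ℝ, Model n) 𝓘(ℝ, Model n) (extChartAt 𝓘(ℝ, Model n) x₀)
    ((extChartAt 𝓘(ℝ, Model n) x₀).symm y)

/-- The metric `g` in the preferred chart around `x₀` (meaningful on the target of the chart). -/
def chartMetric (g : RiemannianMetric n M) (x₀ : M) (y : Model n) :
    Model n →L[ℝ] Model n →L[ℝ] ℝ :=
  ContinuousLinearMap.bilinearComp (E := Model n) (F := Model n)
    (g.inner ((extChartAt 𝓘(ℝ, Model n) x₀).symm y))
    (chartSymmDeriv x₀ y) (chartSymmDeriv x₀ y)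

/-- A field of endomorphisms of the tangent spaces in the preferred chart around `x₀`. -/
def chartEnd (J : ∀ x : M, TangentSpace 𝓘(ℝ, Model n) x →L[ℝ] TangentSpace 𝓘(ℝ, Model n) x)
    (x₀ : M) (y : Model n) : Model n →L[ℝ] Model n :=
  chartDeriv x₀ y ∘L J ((extChartAt 𝓘(ℝ, Model n) x₀).symm y) ∘L chartSymmDeriv x₀ y

/-- The curvature tensor of `g` at `x`, computed in the preferred chart around `x`. The tangent
space at `x` is by definition the model space, and the differential at `x` of the preferred chart
around `x` is the identity. -/
def curvature (g : RiemannianMetric n M) (x : M) (u v w : TangentSpace 𝓘(ℝ, Model n) x) :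
    TangentSpace 𝓘(ℝ, Model n) x :=
  localCurvature (E := Model n) (chartMetric g x) (extChartAt 𝓘(ℝ, Model n) x x) u v w

/-- The sectional curvature `K(u, v)` of the plane spanned by `u` and `v` (meaningful for linearly
independent `u` and `v`). -/
def sectionalCurvature (g : RiemannianMetric n M) (x : M) (u v : TangentSpace 𝓘(ℝ, Model n) x) :
    ℝ :=
  g.inner x (curvature g x u v v) u
    / (g.inner x u u * g.inner x v v - g.inner x u v ^ 2)

/-- The linear map `X ↦ R(X, v) w`. -/
def curvatureOperator (g : RiemannianMetric n M) (x : M) (v w : TangentSpace 𝓘(ℝ, Model n) x) :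
    TangentSpace 𝓘(ℝ, Model n) x →ₗ[ℝ] TangentSpace 𝓘(ℝ, Model n) x where
  toFun X := curvature g x X v w
  map_add' X Y := localCurvature_add (E := Model n) _ _ X Y v w
  map_smul' c X := localCurvature_smul (E := Model n) _ c _ X v w

/-- The Ricci curvature `Ric(v) = Ric(v, v)`, the trace of `X ↦ R(X, v) v`. -/
def ricci (g : RiemannianMetric n M) (x : M) (v : TangentSpace 𝓘(ℝ, Model n) x) : ℝ :=
  LinearMap.trace ℝ (TangentSpace 𝓘(ℝ, Model n) x) (curvatureOperator g x v v)

variable (n M) in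
/-- A Kaehler structure: a Riemannian metric together with a smooth orthogonal almost complex
structure that is parallel for the Levi-Civita connection. -/
structure KaehlerStructure where
  /-- The Riemannian metric. -/
  metric : RiemannianMetric n M
  /-- The complex structure of the tangent spaces. -/
  J : ∀ x : M, TangentSpace 𝓘(ℝ, Model n) x →L[ℝ] TangentSpace 𝓘(ℝ, Model n) x
  contMDiff_J : ContMDiff 𝓘(ℝ, Model n) (𝓘(ℝ, Model n).prod 𝓘(ℝ, Model n →L[ℝ] Model n)) ∞
    (fun x : M ↦ Bundle.TotalSpace.mk' (Model n →L[ℝ] Model n)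
      (E := fun x : M ↦ TangentSpace 𝓘(ℝ, Model n) x →L[ℝ] TangentSpace 𝓘(ℝ, Model n) x) x (J x))
  J_J : ∀ (x : M) (v : TangentSpace 𝓘(ℝ, Model n) x), J x (J x v) = -v
  inner_J_J : ∀ (x : M) (u v : TangentSpace 𝓘(ℝ, Model n) x),
    metric.inner x (J x u) (J x v) = metric.inner x u v
  parallel_J : ∀ x₀ : M, ∀ y ∈ (extChartAt 𝓘(ℝ, Model n) x₀).target, ∀ u v : Model n,
    localCovDerivEnd (chartMetric metric x₀) (chartEnd J x₀) y u v = 0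

/-- A complex vector subspace of the tangent space at `x`, of complex dimension `ℓ`. -/
def KaehlerStructure.IsComplexSubspace (K : KaehlerStructure n M) (x : M)
    (V : Submodule ℝ (TangentSpace 𝓘(ℝ, Model n) x)) (ℓ : ℕ) : Prop :=
  (∀ S ∈ V, K.J x S ∈ V) ∧ Module.finrank ℝ V = 2 * ℓ

end Manifold

/-! ### The hyperbolic space of curvature `-1` -/

/-- The flat Lorentzian space of dimension `N + 1`; the first coordinate is the time coordinate. -/
abbrev LorentzSpace (N : ℕ) : Type := ℝ × EuclideanSpace ℝ (Fin N)

/-- The Lorentzian inner product. -/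
def lorentz {N : ℕ} (a b : LorentzSpace N) : ℝ := inner ℝ a.2 b.2 - a.1 * b.1

/-- The hyperbolic space of dimension `N` and curvature `-1`: the upper sheet of the hyperboloid
`⟨a, a⟩ = -1`, with the metric induced by the Lorentzian inner product. -/
def HyperbolicSpace (N : ℕ) : Type := {a : LorentzSpace N // lorentz a a = -1 ∧ 0 < a.1}

/-- The inclusion of the hyperbolic space in the Lorentzian space. -/
def HyperbolicSpace.incl {N : ℕ} (a : HyperbolicSpace N) : LorentzSpace N := a.1

/-- A smooth isometric immersion of `(M, g)` in the hyperbolic space. The hyperbolic space is an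
embedded submanifold of the Lorentzian space with the induced metric, so that smoothness and the
preservation of the metric are tested on the composition with the inclusion. -/
structure IsIsometricImmersion {n N : ℕ} {M : Type*} [TopologicalSpace M]
    [ChartedSpace (Model n) M] [IsManifold 𝓘(ℝ, Model n) ∞ M]
    (g : RiemannianMetric n M) (f : M → HyperbolicSpace N) : Prop where
  contMDiff : ContMDiff 𝓘(ℝ, Model n) 𝓘(ℝ, LorentzSpace N) ∞ (fun x ↦ (f x).incl)
  isometric : ∀ (x : M) (u v : TangentSpace 𝓘(ℝ, Model n) x),
    lorentz (mfderiv 𝓘(ℝ, Model n) 𝓘(ℝ, LorentzSpace N) (fun x ↦ (f x).incl) x u)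
      (mfderiv 𝓘(ℝ, Model n) 𝓘(ℝ, LorentzSpace N) (fun x ↦ (f x).incl) x v) = g.inner x u v

end KaehlerHyperbolic

end

/-!
Regarded as a map into Lorentz space, the immersion has the timelike unit vector `f` itself as a
normal vector, and its second fundamental form `a` takes values in a Lorentzian space of
dimension `p + 1` and satisfies `⟨a(X, Y), f⟩ = -⟨X, Y⟩`. Since `J` is parallel, the curvature is
`J`-invariant, and the Gauss equation makes the Hermitian form with real part
`h(X, Y) = a(X, Y) + a(JX, JY)` flat. By Moore's argument, a flat bilinear form takes isotropic
values on the kernel of `β(X, ·)` for a vector `X` of maximal rank; as `2 (p + 1) < 2 n`, every such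
kernel meets every kernel of `β(Z, ·)`. In Lorentzian signature mutually orthogonal null vectors are
proportional, so there is a null normal vector `v` with `⟨v, f⟩ = -2` which is orthogonal to all
values of `h`. The remaining part `h - ⟨·, ·⟩ v` is again flat, with values in the positive
definite space of dimension `p - 1` orthogonal to `f` and `v`, and therefore vanishes on the
diagonal of a complex subspace of complex dimension at least `n - p + 1`. For `S` in that
subspace `h(S, S) = |S|² v`, and the signs of `K(S, JS)` and `Ric(S)` follow from the Gauss
equation and `⟨X, Y⟩ ⟨v, a(X, Y)⟩ ≤ |a(X, Y)|²`, as `a(X, Y) - ⟨X, Y⟩ v / 2` is orthogonal to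
`f`.

The estimate is attained by the product of `p - 1` round spheres of dimension two and `n - p + 1`
planes, which lies in the Euclidean space of dimension `2 n + p - 1`, a horosphere of the
hyperbolic space: there `K(S, JS)` and `Ric(S)` are non-positive only if `S` is tangent to the
planes.
-/

noncomputable section

namespace KaehlerHyperbolic

/-! ### Flat bilinear maps -/

section Regular

variable {𝕜 V U : Type*} [Field 𝕜] [AddCommGroup V] [Module 𝕜 V] [AddCommGroup U] [Module 𝕜 U]

theorem exists_ne_zero_linearIndependent_add_smul [Infinite 𝕜] {ι : Type*} [Finite ι]
    {u : ι → U} (hu : LinearIndependent 𝕜 u) (v : ι → U) :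
    ∃ t : 𝕜, t ≠ 0 ∧ LinearIndependent 𝕜 fun i ↦ u i + t • v i := by
  have := Fintype.ofFinite ι
  obtain ⟨π, hπ⟩ := (Fintype.linearCombination 𝕜 u).exists_leftInverse_of_injective
    (LinearMap.ker_eq_bot.2 hu.fintypeLinearCombination_injective)
  let N : Module.End 𝕜 (ι → 𝕜) := π ∘ₗ Fintype.linearCombination 𝕜 v
  obtain ⟨s, hs⟩ := ((Module.End.finite_hasEigenvalue N).union
    (Set.finite_singleton 0)).infinite_compl.nonempty
  simp only [Set.mem_compl_iff, Set.mem_union, Set.mem_singleton_iff, not_or] at hs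
  obtain ⟨hsN, hs0⟩ := hs
  refine ⟨-s⁻¹, neg_ne_zero.2 (inv_ne_zero hs0), Fintype.linearIndependent_iff.2 fun c hc ↦ ?_⟩
  have hNc : N c = s • c := by
    have huv : Fintype.linearCombination 𝕜 v c = s • Fintype.linearCombination 𝕜 u c := by
      rw [← inv_smul_eq_iff₀ hs0, ← sub_eq_zero, ← neg_eq_zero, neg_sub, sub_eq_add_neg, ← neg_smul]
      simpa only [Fintype.linearCombination_apply, smul_add, Finset.sum_add_distrib,
        Finset.smul_sum, smul_comm (-s⁻¹)] using hc
    rw [LinearMap.comp_apply, huv, map_smul, ← LinearMap.comp_apply, hπ, LinearMap.id_apply]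
  by_contra! hc0
  exact hsN (Module.End.hasEigenvalue_of_hasEigenvector
    (Module.End.hasEigenvector_iff.2 ⟨Module.End.mem_eigenspace_iff.2 hNc, Function.ne_iff.2 hc0⟩))

theorem exists_forall_finrank_range_le [FiniteDimensional 𝕜 U] (b : V →ₗ[𝕜] V →ₗ[𝕜] U) :
    ∃ X, ∀ X', Module.finrank 𝕜 (LinearMap.range (b X')) ≤
      Module.finrank 𝕜 (LinearMap.range (b X)) := by
  have hbdd : BddAbove (Set.range fun X ↦ Module.finrank 𝕜 (LinearMap.range (b X))) :=
    ⟨Module.finrank 𝕜 U, by rintro _ ⟨X, rfl⟩; exact Submodule.finrank_le _⟩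
  obtain ⟨X, hX⟩ := Nat.sSup_mem (Set.range_nonempty _) hbdd
  exact ⟨X, fun X' ↦ (le_csSup hbdd ⟨X', rfl⟩).trans hX.ge⟩

theorem apply_mem_range_of_finrank_range_add_smul_le [Infinite 𝕜] [FiniteDimensional 𝕜 U]
    {A C : V →ₗ[𝕜] U}
    (hA : ∀ t : 𝕜, Module.finrank 𝕜 (LinearMap.range (A + t • C)) ≤
      Module.finrank 𝕜 (LinearMap.range A)) {Y : V} (hY : A Y = 0) :
    C Y ∈ LinearMap.range A := by
  by_contra hCY
  let β := Module.finBasis 𝕜 (LinearMap.range A)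
  choose e he using fun i ↦ (β i).2
  have hli : LinearIndependent 𝕜 fun o : Option (Fin _) ↦ o.elim (C Y) fun i ↦ A (e i) := by
    have hβ : LinearIndependent 𝕜 fun i ↦ A (e i) := by
      simp only [he]
      exact β.linearIndependent.map' (Submodule.subtype _) (Submodule.ker_subtype _)
    refine linearIndependent_option.2 ⟨hβ, fun h ↦ hCY ?_⟩
    refine Submodule.span_le.2 ?_ h
    rintro _ ⟨i, rfl⟩
    exact LinearMap.mem_range_self _ _
  obtain ⟨t, ht, hlit⟩ := exists_ne_zero_linearIndependent_add_smul hli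
    fun o ↦ o.elim 0 fun i ↦ C (e i)
  have hspan : Submodule.span 𝕜 (Set.range fun o : Option (Fin _) ↦
      (o.elim (C Y) fun i ↦ A (e i)) + t • (o.elim 0 fun i ↦ C (e i))) ≤
        LinearMap.range (A + t • C) := by
    refine Submodule.span_le.2 ?_
    rintro _ ⟨_ | i, rfl⟩
    · exact ⟨t⁻¹ • Y, by simp [hY, ht]⟩
    · exact ⟨e i, rfl⟩
  have hcard := (Submodule.finrank_mono hspan).trans (hA t)
  rw [finrank_span_eq_card hlit, Fintype.card_option, Fintype.card_fin] at hcard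
  exact Nat.not_succ_le_self _ hcard

theorem exists_forall_ker_mem_range [Infinite 𝕜] [FiniteDimensional 𝕜 U]
    (b : V →ₗ[𝕜] V →ₗ[𝕜] U) :
    ∃ X, ∀ Y, b X Y = 0 → ∀ Z, b Z Y ∈ LinearMap.range (b X) := by
  obtain ⟨X, hX⟩ := exists_forall_finrank_range_le b
  refine ⟨X, fun Y hY Z ↦ apply_mem_range_of_finrank_range_add_smul_le (fun t ↦ ?_) hY⟩
  rw [← map_smul, ← map_add]
  exact hX (X + t • Z)

end Regular

section Flat

variable {𝕜 V U : Type*} [Field 𝕜] [AddCommGroup V] [Module 𝕜 V] [AddCommGroup U] [Module 𝕜 U]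

/-- A bilinear map `β` is *flat* for the bilinear form `C` when `C(β(X, Y), β(Z, T))` is symmetric
in `Y` and `T`; this is the algebraic form of a Gauss equation with vanishing curvature. -/
def IsFlat (C : LinearMap.BilinForm 𝕜 U) (β : V →ₗ[𝕜] V →ₗ[𝕜] U) : Prop :=
  ∀ X Y Z T, C (β X Y) (β Z T) = C (β X T) (β Z Y)

namespace IsFlat

variable {C : LinearMap.BilinForm 𝕜 U} {β : V →ₗ[𝕜] V →ₗ[𝕜] U}

theorem apply_eq_zero (hβ : IsFlat C β) {X Y : V} (hY : β X Y = 0) (Z T : V) :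
    C (β X T) (β Z Y) = 0 := by
  rw [← hβ, hY, map_zero, LinearMap.zero_apply]

theorem exists_isotropic_ker [Infinite 𝕜] [FiniteDimensional 𝕜 U] (hβ : IsFlat C β) :
    ∃ X, ∀ Y Y', β X Y = 0 → β X Y' = 0 → ∀ Z Z', C (β Z Y) (β Z' Y') = 0 := by
  obtain ⟨X, hX⟩ := exists_forall_ker_mem_range β
  refine ⟨X, fun Y Y' hY hY' Z Z' ↦ ?_⟩
  obtain ⟨T, hT⟩ := hX Y hY Z
  rw [← hT, hβ.apply_eq_zero hY']

theorem exists_ker_inter_ker [FiniteDimensional 𝕜 V] [FiniteDimensional 𝕜 U] (hβ : IsFlat C β)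
    (hC : C.Nondegenerate) (hdim : Module.finrank 𝕜 U < Module.finrank 𝕜 V) (X Z : V) :
    ∃ Y, Y ≠ 0 ∧ β X Y = 0 ∧ β Z Y = 0 := by
  have hmaps : ∀ Y ∈ LinearMap.ker (β X), β Z Y ∈ C.orthogonal (LinearMap.range (β X)) := by
    rintro Y hY _ ⟨T, rfl⟩
    exact hβ.apply_eq_zero hY Z T
  have hlt : Module.finrank 𝕜 (C.orthogonal (LinearMap.range (β X))) <
      Module.finrank 𝕜 (LinearMap.ker (β X)) := by
    have horth := C.finrank_orthogonal hC (LinearMap.range (β X))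
    have hrank := (β X).finrank_range_add_finrank_ker
    have hle := Submodule.finrank_le (LinearMap.range (β X))
    omega
  obtain ⟨Y, hY, hY0⟩ := (Submodule.ne_bot_iff _).1
    (LinearMap.ker_ne_bot_of_finrank_lt (f := (β Z).restrict hmaps) hlt)
  exact ⟨Y, by simpa using hY0, Y.2, by simpa [Subtype.ext_iff] using hY⟩

end IsFlat

/-- The form `B ⊖ B` on `U × U`. -/
def doubledForm (B : LinearMap.BilinForm 𝕜 U) : LinearMap.BilinForm 𝕜 (U × U) :=
  B.compl₁₂ (LinearMap.fst 𝕜 U U) (LinearMap.fst 𝕜 U U) -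
    B.compl₁₂ (LinearMap.snd 𝕜 U U) (LinearMap.snd 𝕜 U U)

@[simp]
theorem doubledForm_apply (B : LinearMap.BilinForm 𝕜 U) (a b : U × U) :
    doubledForm B a b = B a.1 b.1 - B a.2 b.2 := rfl

theorem doubledForm_nondegenerate {B : LinearMap.BilinForm 𝕜 U} (hB : B.Nondegenerate) :
    (doubledForm B).Nondegenerate := by
  refine ⟨fun a ha ↦ Prod.ext (hB.1 _ fun b ↦ ?_) (hB.1 _ fun b ↦ ?_),
    fun a ha ↦ Prod.ext (hB.2 _ fun b ↦ ?_) (hB.2 _ fun b ↦ ?_)⟩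
  · simpa using ha (b, 0)
  · simpa using ha (0, b)
  · simpa using ha (b, 0)
  · simpa using ha (0, b)

end Flat

/-! ### Second fundamental forms of Kaehler submanifolds in Lorentzian signature -/

section Hermitian

variable {V W : Type*} [AddCommGroup V] [Module ℝ V] [AddCommGroup W] [Module ℝ W]

/-- The Hermitian form with real part `h`, as the pair `(X, Y) ↦ (h X Y, h X (J Y))` of its real and
imaginary parts. -/
def hermitianPair (J : V →ₗ[ℝ] V) (h : V →ₗ[ℝ] V →ₗ[ℝ] W) : V →ₗ[ℝ] V →ₗ[ℝ] W × W :=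
  LinearMap.mk₂ ℝ (fun X Y ↦ (h X Y, h X (J Y))) (by simp) (by simp) (by simp) (by simp)

@[simp]
theorem hermitianPair_apply (J : V →ₗ[ℝ] V) (h : V →ₗ[ℝ] V →ₗ[ℝ] W) (X Y : V) :
    hermitianPair J h X Y = (h X Y, h X (J Y)) := rfl

theorem hermitianPair_apply_J_eq_zero {J : V →ₗ[ℝ] V} (hJ : ∀ X, J (J X) = -X)
    {h : V →ₗ[ℝ] V →ₗ[ℝ] W} {X Y : V} (hY : hermitianPair J h X Y = 0) :
    hermitianPair J h X (J Y) = 0 := by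
  simp only [hermitianPair_apply, Prod.mk_eq_zero, hJ, map_neg, neg_eq_zero] at hY ⊢
  exact hY.symm

theorem finrank_range_hermitianPair_le [FiniteDimensional ℝ W] (J : V →ₗ[ℝ] V)
    {h : V →ₗ[ℝ] V →ₗ[ℝ] W} {P : Submodule ℝ W} (hP : ∀ X Y, h X Y ∈ P) (X : V) :
    Module.finrank ℝ (LinearMap.range (hermitianPair J h X)) ≤ 2 * Module.finrank ℝ P := by
  have hrange : LinearMap.range (hermitianPair J h X) ≤
      LinearMap.range (P.subtype.prodMap P.subtype) := by
    rintro _ ⟨Y, rfl⟩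
    exact ⟨(⟨h X Y, hP X Y⟩, ⟨h X (J Y), hP X (J Y)⟩), rfl⟩
  have hle := (Submodule.finrank_mono hrange).trans (LinearMap.finrank_range_le _)
  rwa [Module.finrank_prod, ← two_mul] at hle

/-- A symmetric `J`-invariant bilinear map whose associated Hermitian form is flat. -/
structure IsFlatHermitian (J : V →ₗ[ℝ] V) (B : LinearMap.BilinForm ℝ W)
    (h : V →ₗ[ℝ] V →ₗ[ℝ] W) : Prop where
  symm : ∀ X Y, h X Y = h Y X
  invariant : ∀ X Y, h (J X) (J Y) = h X Y
  flat : IsFlat (doubledForm B) (hermitianPair J h)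

namespace IsFlatHermitian

variable {J : V →ₗ[ℝ] V} {B : LinearMap.BilinForm ℝ W} {h : V →ₗ[ℝ] V →ₗ[ℝ] W}

theorem apply_J_self (hh : IsFlatHermitian J B h) (hJ : ∀ X, J (J X) = -X) (Y : V) :
    h Y (J Y) = 0 := by
  have hneg : h Y (J Y) = -h Y (J Y) := by
    conv_lhs => rw [← hh.invariant, hJ, map_neg, hh.symm]
  have htwo : (2 : ℝ) • h Y (J Y) = 0 := by rw [two_smul, ← eq_neg_iff_add_eq_zero, ← hneg]
  exact (smul_eq_zero.1 htwo).resolve_left two_ne_zero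

theorem form_apply_self_eq_zero (hh : IsFlatHermitian J B h) (hJ : ∀ X, J (J X) = -X) {Y Z : V}
    (hZY : hermitianPair J h Z Y = 0) : B (h Z Z) (h Y Y) = 0 := by
  simpa [hh.apply_J_self hJ] using hh.flat.apply_eq_zero hZY Y Z

theorem exists_isotropic_ker [FiniteDimensional ℝ W] (hh : IsFlatHermitian J B h)
    (hJ : ∀ X, J (J X) = -X) :
    ∃ X, ∀ Y Y', hermitianPair J h X Y = 0 → hermitianPair J h X Y' = 0 →
      B (h Y Y) (h Y' Y') = 0 := by
  obtain ⟨X, hX⟩ := hh.flat.exists_isotropic_ker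
  exact ⟨X, fun Y Y' hY hY' ↦ by simpa [hh.apply_J_self hJ] using hX Y Y' hY hY' Y Y'⟩

theorem exists_ker_inter_ker [FiniteDimensional ℝ V] [FiniteDimensional ℝ W]
    (hh : IsFlatHermitian J B h) (hB : B.Nondegenerate)
    (hdim : 2 * Module.finrank ℝ W < Module.finrank ℝ V) (X Z : V) :
    ∃ Y, Y ≠ 0 ∧ hermitianPair J h X Y = 0 ∧ hermitianPair J h Z Y = 0 :=
  hh.flat.exists_ker_inter_ker (doubledForm_nondegenerate hB)
    (by rwa [Module.finrank_prod, ← two_mul]) X Z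

end IsFlatHermitian

end Hermitian

section SecondForm

variable {V W : Type*} [AddCommGroup V] [Module ℝ V] [AddCommGroup W] [Module ℝ W]

/-- The right-hand side of the Gauss equation `⟨R(X, Y) Z, T⟩ = ⟨a(X, T), a(Y, Z)⟩ -
⟨a(X, Z), a(Y, T)⟩` in a flat ambient space, for the second fundamental form `a`. -/
def gaussForm (B : LinearMap.BilinForm ℝ W) (a : V →ₗ[ℝ] V →ₗ[ℝ] W) (X Y Z T : V) : ℝ :=
  B (a X T) (a Y Z) - B (a X Z) (a Y T)

/-- The algebraic properties of the second fundamental form `a`, with values in a Lorentzian normal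
space `(W, B)`, of a Kaehler submanifold of the hyperbolic space at the point `f`, which is a
timelike unit vector normal to the submanifold. -/
structure IsKaehlerSecondForm (J : V →ₗ[ℝ] V) (G : LinearMap.BilinForm ℝ V)
    (B : LinearMap.BilinForm ℝ W) (f : W) (a : V →ₗ[ℝ] V →ₗ[ℝ] W) : Prop where
  J_J : ∀ X, J (J X) = -X
  metric_symm : ∀ X Y, G X Y = G Y X
  metric_pos : ∀ X, X ≠ 0 → 0 < G X X
  metric_J : ∀ X Y, G (J X) (J Y) = G X Y
  form_symm : ∀ v w, B v w = B w v
  form_self : B f f = -1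
  form_pos : ∀ w, B w f = 0 → w ≠ 0 → 0 < B w w
  symm : ∀ X Y, a X Y = a Y X
  apply_f : ∀ X Y, B (a X Y) f = -G X Y
  kaehler : ∀ X Y Z T, gaussForm B a X Y (J Z) (J T) = gaussForm B a X Y Z T

/-- The `J`-invariant part (up to a factor `2`) of a bilinear map. -/
def invariantPart (J : V →ₗ[ℝ] V) (a : V →ₗ[ℝ] V →ₗ[ℝ] W) : V →ₗ[ℝ] V →ₗ[ℝ] W :=
  a + a.compl₁₂ J J

@[simp]
theorem invariantPart_apply (J : V →ₗ[ℝ] V) (a : V →ₗ[ℝ] V →ₗ[ℝ] W) (X Y : V) :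
    invariantPart J a X Y = a X Y + a (J X) (J Y) := rfl

theorem nondegenerate_of_orthogonal_pos {B : LinearMap.BilinForm ℝ W} {f : W}
    (hB : ∀ v w, B v w = B w v) (hpos : ∀ w, B w f = 0 → w ≠ 0 → 0 < B w w) : B.Nondegenerate := by
  refine (LinearMap.IsRefl.nondegenerate_iff_separatingLeft
    (LinearMap.BilinForm.IsSymm.isRefl ⟨hB⟩)).2 fun w hw ↦ ?_
  by_contra hne
  exact (hpos w (hw f) hne).ne' (hw w)

/-- A null vector, normalized by its product with `f`, which is orthogonal to the `J`-invariant part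
of `a`. -/
structure IsNullNormal (J : V →ₗ[ℝ] V) (B : LinearMap.BilinForm ℝ W) (f : W)
    (a : V →ₗ[ℝ] V →ₗ[ℝ] W) (v : W) : Prop where
  form_self : B v v = 0
  form_f : B v f = -2
  form_invariantPart : ∀ X Y, B v (invariantPart J a X Y) = 0

/-- The component of `invariantPart J a` orthogonal to the plane spanned by `f` and a null normal
`v`. -/
def reducedPart (J : V →ₗ[ℝ] V) (G : LinearMap.BilinForm ℝ V) (a : V →ₗ[ℝ] V →ₗ[ℝ] W) (v : W) :
    V →ₗ[ℝ] V →ₗ[ℝ] W :=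
  invariantPart J a - G.compr₂ (LinearMap.toSpanSingleton ℝ W v)

theorem reducedPart_apply (J : V →ₗ[ℝ] V) (G : LinearMap.BilinForm ℝ V) (a : V →ₗ[ℝ] V →ₗ[ℝ] W)
    (v : W) (X Y : V) : reducedPart J G a v X Y = invariantPart J a X Y - G X Y • v := rfl

namespace IsKaehlerSecondForm

variable {J : V →ₗ[ℝ] V} {G : LinearMap.BilinForm ℝ V} {B : LinearMap.BilinForm ℝ W} {f : W}
  {a : V →ₗ[ℝ] V →ₗ[ℝ] W}

theorem form_nonneg (H : IsKaehlerSecondForm J G B f a) {w : W} (hw : B w f = 0) : 0 ≤ B w w := by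
  rcases eq_or_ne w 0 with rfl | h
  · simp
  · exact (H.form_pos w hw h).le

theorem eq_zero_of_form_self_eq_zero (H : IsKaehlerSecondForm J G B f a) {w : W} (hw : B w f = 0)
    (h : B w w = 0) : w = 0 := by
  by_contra h0
  exact (H.form_pos w hw h0).ne' h

theorem eq_of_isotropic (H : IsKaehlerSecondForm J G B f a) {v w : W} (hv : B v v = 0)
    (hw : B w w = 0) (hvw : B v w = 0) (hf : B v f = B w f) : v = w := by
  refine sub_eq_zero.1 (H.eq_zero_of_form_self_eq_zero ?_ ?_)
  · simp [hf]
  · simp [hv, hw, hvw, H.form_symm w v]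

theorem invariantPart_apply_f (H : IsKaehlerSecondForm J G B f a) (X Y : V) :
    B (invariantPart J a X Y) f = -2 * G X Y := by
  simp only [invariantPart_apply, map_add, LinearMap.add_apply, H.apply_f, H.metric_J]
  ring

theorem metric_apply_J_self (H : IsKaehlerSecondForm J G B f a) (X : V) : G X (J X) = 0 := by
  have hneg := H.metric_J X (J X)
  rw [H.J_J, map_neg, H.metric_symm (J X)] at hneg
  linarith

theorem isFlatHermitian_invariantPart (H : IsKaehlerSecondForm J G B f a) :
    IsFlatHermitian J B (invariantPart J a) where
  symm X Y := by simp [H.symm X Y, H.symm (J X)]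
  invariant X Y := by simp [H.J_J, add_comm]
  flat X Y Z T := by
    have k₁ := H.kaehler X Z T Y
    have k₂ := H.kaehler (J X) (J Z) T Y
    have k₃ := H.kaehler X (J Z) T (J Y)
    have k₄ := H.kaehler (J X) Z T (J Y)
    simp only [gaussForm, doubledForm_apply, hermitianPair_apply, invariantPart_apply, H.J_J,
      map_neg, map_add, LinearMap.add_apply, LinearMap.neg_apply] at k₁ k₂ k₃ k₄ ⊢
    linear_combination k₂ - k₁ - k₃ - k₄

theorem exists_isNullNormal [FiniteDimensional ℝ V] [FiniteDimensional ℝ W]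
    (H : IsKaehlerSecondForm J G B f a) (hdim : 2 * Module.finrank ℝ W < Module.finrank ℝ V) :
    ∃ v, IsNullNormal J B f a v := by
  have hh := H.isFlatHermitian_invariantPart
  obtain ⟨X, hX⟩ := hh.exists_isotropic_ker H.J_J
  have hker :=
    hh.exists_ker_inter_ker (nondegenerate_of_orthogonal_pos H.form_symm H.form_pos) hdim X
  let normalized (Y : V) : W := (G Y Y)⁻¹ • invariantPart J a Y Y
  have hf {Y : V} (hY : Y ≠ 0) : B (normalized Y) f = -2 := by
    have hG := (H.metric_pos Y hY).ne'
    simp only [normalized, map_smul, LinearMap.smul_apply, H.invariantPart_apply_f, smul_eq_mul]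
    field_simp
  have hnull {Y Y' : V} (hY : hermitianPair J (invariantPart J a) X Y = 0)
      (hY' : hermitianPair J (invariantPart J a) X Y' = 0) :
      B (normalized Y) (normalized Y') = 0 := by
    simp only [normalized, map_smul, LinearMap.smul_apply, hX Y Y' hY hY', smul_zero]
  obtain ⟨Y₀, hY₀, hXY₀, -⟩ := hker X
  have hdiag (Z : V) : B (normalized Y₀) (invariantPart J a Z Z) = 0 := by
    obtain ⟨Y, hY, hXY, hZY⟩ := hker Z
    rw [H.eq_of_isotropic (hnull hXY₀ hXY₀) (hnull hXY hXY) (hnull hXY₀ hXY)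
      ((hf hY₀).trans (hf hY).symm), map_smul, LinearMap.smul_apply, H.form_symm,
      hh.form_apply_self_eq_zero H.J_J hZY, smul_zero]
  refine ⟨normalized Y₀, hnull hXY₀ hXY₀, hf hY₀, fun Y Z ↦ ?_⟩
  have hpolar := hdiag (Y + Z)
  simp only [map_add, LinearMap.add_apply, hdiag Y, hdiag Z, hh.symm Z Y] at hpolar
  linarith

variable {v : W}

theorem form_reducedPart_f (H : IsKaehlerSecondForm J G B f a) (hv : IsNullNormal J B f a v)
    (X Y : V) : B (reducedPart J G a v X Y) f = 0 := by
  simp only [reducedPart_apply, map_sub, LinearMap.sub_apply, H.invariantPart_apply_f, map_smul,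
    LinearMap.smul_apply, hv.form_f, smul_eq_mul]
  ring

theorem form_reducedPart_null (H : IsKaehlerSecondForm J G B f a) (hv : IsNullNormal J B f a v)
    (X Y : V) : B (reducedPart J G a v X Y) v = 0 := by
  rw [H.form_symm, reducedPart_apply, map_sub, hv.form_invariantPart, map_smul, hv.form_self,
    smul_zero, sub_zero]

theorem isFlatHermitian_reducedPart (H : IsKaehlerSecondForm J G B f a)
    (hv : IsNullNormal J B f a v) : IsFlatHermitian J B (reducedPart J G a v) where
  symm X Y := by
    simp only [reducedPart_apply, H.isFlatHermitian_invariantPart.symm X Y, H.metric_symm X Y]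
  invariant X Y := by
    simp only [reducedPart_apply, H.isFlatHermitian_invariantPart.invariant, H.metric_J]
  flat X Y Z T := by
    have hform (X Y Z T : V) : B (reducedPart J G a v X Y) (reducedPart J G a v Z T) =
        B (invariantPart J a X Y) (invariantPart J a Z T) := by
      rw [reducedPart_apply J G a v Z T, map_sub, map_smul, H.form_reducedPart_null hv, smul_zero,
        sub_zero, reducedPart_apply, map_sub, LinearMap.sub_apply, map_smul, LinearMap.smul_apply,
        hv.form_invariantPart, smul_zero, sub_zero]
    simpa only [doubledForm_apply, hermitianPair_apply, hform] using
      H.isFlatHermitian_invariantPart.flat X Y Z T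

theorem finrank_orthogonal_add_two [FiniteDimensional ℝ W] (H : IsKaehlerSecondForm J G B f a)
    (hv : IsNullNormal J B f a v) :
    Module.finrank ℝ (LinearMap.ker ((B.flip f).prod (B.flip v))) + 2 = Module.finrank ℝ W := by
  have hsurj : LinearMap.range ((B.flip f).prod (B.flip v)) = ⊤ := by
    refine LinearMap.range_eq_top.2 fun ⟨s, t⟩ ↦ ⟨(-t / 2) • f + (t / 4 - s / 2) • v,
      Prod.ext (?_ : B _ f = s) (?_ : B _ v = t)⟩ <;>
    · simp only [map_add, map_smul, LinearMap.add_apply, LinearMap.smul_apply, hv.form_self,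
        hv.form_f, H.form_symm f v, H.form_self, smul_eq_mul]
      ring
  have hrank := ((B.flip f).prod (B.flip v)).finrank_range_add_finrank_ker
  rw [hsurj, finrank_top, Module.finrank_prod, Module.finrank_self] at hrank
  omega

theorem exists_subspace [FiniteDimensional ℝ V] [FiniteDimensional ℝ W]
    (H : IsKaehlerSecondForm J G B f a) (hv : IsNullNormal J B f a v) :
    ∃ S : Submodule ℝ V, (∀ X ∈ S, J X ∈ S) ∧
      Module.finrank ℝ V + 4 ≤ Module.finrank ℝ S + 2 * Module.finrank ℝ W ∧
      ∀ X ∈ S, invariantPart J a X X = G X X • v := by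
  obtain ⟨X, hX⟩ := (H.isFlatHermitian_reducedPart hv).exists_isotropic_ker H.J_J
  refine ⟨LinearMap.ker (hermitianPair J (reducedPart J G a v) X),
    fun Y hY ↦ hermitianPair_apply_J_eq_zero H.J_J hY, ?_, fun Y hY ↦ ?_⟩
  · have hrange := finrank_range_hermitianPair_le J
      (P := LinearMap.ker ((B.flip f).prod (B.flip v)))
      (fun Y Z ↦ Prod.ext (H.form_reducedPart_f hv Y Z) (H.form_reducedPart_null hv Y Z)) X
    have hrank := (hermitianPair J (reducedPart J G a v) X).finrank_range_add_finrank_ker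
    have horth := H.finrank_orthogonal_add_two hv
    omega
  · exact sub_eq_zero.1
      (H.eq_zero_of_form_self_eq_zero (H.form_reducedPart_f hv Y Y) (hX Y Y hY hY))

theorem metric_mul_le (H : IsKaehlerSecondForm J G B f a) (hv : IsNullNormal J B f a v) (X Y : V) :
    G X Y * B v (a X Y) ≤ B (a X Y) (a X Y) := by
  have horth : B (a X Y - (G X Y / 2) • v) f = 0 := by
    simp only [map_sub, LinearMap.sub_apply, H.apply_f, map_smul, LinearMap.smul_apply, hv.form_f,
      smul_eq_mul]
    ring
  have hnonneg := H.form_nonneg horth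
  simp only [map_sub, LinearMap.sub_apply, map_smul, LinearMap.smul_apply, hv.form_self,
    smul_eq_mul, H.form_symm (a X Y) v] at hnonneg
  linarith

theorem gaussForm_apply_J_self_nonpos (H : IsKaehlerSecondForm J G B f a)
    (hv : IsNullNormal J B f a v) {S : V} (hS : invariantPart J a S S = G S S • v) :
    gaussForm B a S (J S) (J S) S ≤ 0 := by
  have hSS := H.metric_mul_le hv S S
  have hSJ := H.metric_mul_le hv S (J S)
  have haJ : a (J S) (J S) = G S S • v - a S S := by rw [← hS, invariantPart_apply]; abel
  rw [H.metric_apply_J_self, zero_mul] at hSJ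
  simp only [gaussForm, haJ, H.symm (J S) S, map_sub, map_smul, smul_eq_mul,
    H.form_symm (a S S) v]
  linarith

end IsKaehlerSecondForm

end SecondForm

section Orthonormal

variable {V : Type*} [AddCommGroup V] [Module ℝ V]

/-- A basis that is orthonormal for a bilinear form. -/
def IsOrthonormalBasis {ι : Type*} [DecidableEq ι] (G : LinearMap.BilinForm ℝ V)
    (e : Module.Basis ι ℝ V) : Prop :=
  ∀ i j, G (e i) (e j) = if i = j then 1 else 0

theorem exists_isOrthonormalBasis [FiniteDimensional ℝ V] {G : LinearMap.BilinForm ℝ V}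
    (hsymm : ∀ X Y, G X Y = G Y X) (hpos : ∀ X, X ≠ 0 → 0 < G X X) :
    ∃ e : Module.Basis (Fin (Module.finrank ℝ V)) ℝ V, IsOrthonormalBasis G e := by
  obtain ⟨b, hb⟩ := LinearMap.BilinForm.exists_orthogonal_basis (B := G) ⟨hsymm⟩
  have hb_pos (i) : 0 < G (b i) (b i) := hpos _ (b.ne_zero i)
  refine ⟨b.isUnitSMul (w := fun i ↦ (√(G (b i) (b i)))⁻¹)
    (fun i ↦ (inv_ne_zero (Real.sqrt_pos.2 (hb_pos i)).ne').isUnit), fun i j ↦ ?_⟩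
  simp only [Module.Basis.isUnitSMul_apply, map_smul, LinearMap.smul_apply, smul_eq_mul]
  split_ifs with hij
  · subst hij
    have hsqrt := Real.sqrt_pos.2 (hb_pos i)
    field_simp
    exact (Real.sq_sqrt (hb_pos i).le).symm
  · have hij' : G (b i) (b j) = 0 := hb hij
    simp [hij']

namespace IsOrthonormalBasis

variable {ι κ : Type*} [DecidableEq ι] [DecidableEq κ] {G : LinearMap.BilinForm ℝ V}
  {e : Module.Basis ι ℝ V} {e' : Module.Basis κ ℝ V}

theorem map (he : IsOrthonormalBasis G e) {u : V ≃ₗ[ℝ] V} (hu : ∀ X Y, G (u X) (u Y) = G X Y) :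
    IsOrthonormalBasis G (e.map u) :=
  fun i j ↦ (hu _ _).trans (he i j)

theorem repr_apply (he : IsOrthonormalBasis G e) (X : V) (i : ι) : e.repr X i = G X (e i) := by
  have hcoord : e.coord i = G.flip (e i) := e.ext fun j ↦ by
    simp [Finsupp.single_apply, he j i]
  exact LinearMap.congr_fun hcoord X

variable [Fintype ι] [Fintype κ]

theorem sum_apply_mul (he : IsOrthonormalBasis G e) (φ : V →ₗ[ℝ] ℝ) (X : V) :
    ∑ i, G X (e i) * φ (e i) = φ X := by
  conv_rhs => rw [← e.sum_repr X]
  simp [he.repr_apply]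

theorem trace_eq_sum (he : IsOrthonormalBasis G e) (A : V →ₗ[ℝ] V) :
    LinearMap.trace ℝ V A = ∑ i, G (A (e i)) (e i) := by
  rw [LinearMap.trace_eq_matrix_trace ℝ e, Matrix.trace]
  simp [LinearMap.toMatrix_apply, he.repr_apply]

theorem sum_apply_self_eq (he : IsOrthonormalBasis G e) (he' : IsOrthonormalBasis G e')
    (hsymm : ∀ X Y, G X Y = G Y X) (b : LinearMap.BilinForm ℝ V) :
    ∑ i, b (e i) (e i) = ∑ j, b (e' j) (e' j) :=
  calc
    ∑ i, b (e i) (e i) = ∑ i, ∑ j, G (e i) (e' j) * b (e i) (e' j) :=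
      Finset.sum_congr rfl fun i _ ↦ (he'.sum_apply_mul (b (e i)) (e i)).symm
    _ = ∑ j, ∑ i, G (e' j) (e i) * b.flip (e' j) (e i) := by
      rw [Finset.sum_comm]
      exact Finset.sum_congr rfl fun j _ ↦ Finset.sum_congr rfl fun i _ ↦
        congrArg (· * b (e i) (e' j)) (hsymm _ _)
    _ = ∑ j, b (e' j) (e' j) :=
      Finset.sum_congr rfl fun j _ ↦ he.sum_apply_mul (b.flip (e' j)) (e' j)

end IsOrthonormalBasis

end Orthonormal

section Ricci

variable {V W : Type*} [AddCommGroup V] [Module ℝ V] [AddCommGroup W] [Module ℝ W]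
  {J : V →ₗ[ℝ] V} {G : LinearMap.BilinForm ℝ V} {B : LinearMap.BilinForm ℝ W} {f : W}
  {a : V →ₗ[ℝ] V →ₗ[ℝ] W} {v : W}

namespace IsKaehlerSecondForm

theorem sum_apply_J_J {ι : Type*} [DecidableEq ι] [Fintype ι] (H : IsKaehlerSecondForm J G B f a)
    {e : Module.Basis ι ℝ V} (he : IsOrthonormalBasis G e) (b : LinearMap.BilinForm ℝ V) :
    ∑ i, b (J (e i)) (J (e i)) = ∑ i, b (e i) (e i) := by
  let u : V ≃ₗ[ℝ] V := .ofLinearMap J (-J) (by ext; simp [H.J_J]) (by ext; simp [H.J_J])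
  exact (he.map (u := u) H.metric_J).sum_apply_self_eq he H.metric_symm b

theorem sum_form_null_apply_self {ι : Type*} [DecidableEq ι] [Fintype ι]
    (H : IsKaehlerSecondForm J G B f a) (hv : IsNullNormal J B f a v) {e : Module.Basis ι ℝ V}
    (he : IsOrthonormalBasis G e) : ∑ i, B v (a (e i) (e i)) = 0 := by
  have hJ : ∑ i, B v (a (J (e i)) (J (e i))) = ∑ i, B v (a (e i) (e i)) :=
    H.sum_apply_J_J he (a.compr₂ (B v))
  have hsum : ∑ i, B v (invariantPart J a (e i) (e i)) = 0 :=
    Finset.sum_eq_zero fun i _ ↦ hv.form_invariantPart (e i) (e i)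
  simp only [invariantPart_apply, map_add, Finset.sum_add_distrib, hJ] at hsum
  linarith

theorem gaussForm_comm (H : IsKaehlerSecondForm J G B f a) (X Y Z T : V) :
    gaussForm B a X Y Z T = gaussForm B a Z T X Y := by
  simp only [gaussForm, H.symm X, H.symm Y, H.form_symm (a T X)]

theorem gaussForm_J_left (H : IsKaehlerSecondForm J G B f a) (X Y Z T : V) :
    gaussForm B a (J X) (J Y) Z T = gaussForm B a X Y Z T := by
  rw [H.gaussForm_comm, H.kaehler, H.gaussForm_comm]

theorem gaussForm_J_self (H : IsKaehlerSecondForm J G B f a) (S X : V) :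
    gaussForm B a (J X) S S (J X) = gaussForm B a X (J S) (J S) X :=
  calc
    gaussForm B a (J X) S S (J X) = -gaussForm B a (J X) (J (J S)) S (J X) := by
      simp [gaussForm, H.J_J, sub_eq_add_neg, add_comm]
    _ = -gaussForm B a X (J S) S (J X) := by rw [H.gaussForm_J_left]
    _ = gaussForm B a X (J S) (J (J S)) (J X) := by
      simp [gaussForm, H.J_J, sub_eq_add_neg, add_comm]
    _ = gaussForm B a X (J S) (J S) X := H.kaehler _ _ _ _

theorem gaussForm_add_gaussForm_J_le (H : IsKaehlerSecondForm J G B f a)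
    (hv : IsNullNormal J B f a v) {S : V} (hS : invariantPart J a S S = G S S • v) (X : V) :
    gaussForm B a X S S X + gaussForm B a X (J S) (J S) X ≤
      G S S * B v (a X X) - G S X * B v (a S X) - G (J S) X * B v (a (J S) X) := by
  have hXX : B (a X X) (a S S) + B (a X X) (a (J S) (J S)) = G S S * B v (a X X) := by
    rw [← map_add, ← invariantPart_apply, hS, map_smul, smul_eq_mul, H.form_symm]
  have hSX := H.metric_mul_le hv S X
  have hJSX := H.metric_mul_le hv (J S) X
  simp only [gaussForm, H.symm X S, H.symm X (J S)]
  linarith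

theorem trace_nonpos [FiniteDimensional ℝ V] (H : IsKaehlerSecondForm J G B f a)
    (hv : IsNullNormal J B f a v) {S : V} (hS : invariantPart J a S S = G S S • v)
    {A : V →ₗ[ℝ] V} (hA : ∀ X T, G (A X) T = gaussForm B a X S S T) :
    LinearMap.trace ℝ V A ≤ 0 := by
  obtain ⟨e, he⟩ := exists_isOrthonormalBasis H.metric_symm H.metric_pos
  have htrace : LinearMap.trace ℝ V A = ∑ i, gaussForm B a (e i) S S (e i) := by
    simp only [he.trace_eq_sum, hA]
  have htraceJ : LinearMap.trace ℝ V A = ∑ i, gaussForm B a (e i) (J S) (J S) (e i) := by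
    rw [he.trace_eq_sum]
    exact (H.sum_apply_J_J he (G ∘ₗ A)).symm.trans
      (Finset.sum_congr rfl fun i _ ↦ (hA _ _).trans (H.gaussForm_J_self S (e i)))
  have hmean : 2 * LinearMap.trace ℝ V A ≤ 0 :=
    calc
      2 * LinearMap.trace ℝ V A =
          ∑ i, (gaussForm B a (e i) S S (e i) + gaussForm B a (e i) (J S) (J S) (e i)) := by
        rw [two_mul, Finset.sum_add_distrib, ← htrace, ← htraceJ]
      _ ≤ ∑ i, (G S S * B v (a (e i) (e i)) - G S (e i) * B v (a S (e i)) -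
            G (J S) (e i) * B v (a (J S) (e i))) :=
        Finset.sum_le_sum fun i _ ↦ H.gaussForm_add_gaussForm_J_le hv hS (e i)
      _ = -B v (invariantPart J a S S) := by
        have hSe := he.sum_apply_mul (B v ∘ₗ a S) S
        have hJSe := he.sum_apply_mul (B v ∘ₗ a (J S)) (J S)
        simp only [LinearMap.comp_apply] at hSe hJSe
        rw [Finset.sum_sub_distrib, Finset.sum_sub_distrib, ← Finset.mul_sum,
          H.sum_form_null_apply_self hv he, hSe, hJSe, invariantPart_apply, map_add]
        ring
      _ = 0 := by rw [hv.form_invariantPart, neg_zero]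
  linarith

end IsKaehlerSecondForm

end Ricci

theorem even_finrank_of_apply_apply_eq_neg {𝕜 V : Type*} [Field 𝕜] [LinearOrder 𝕜]
    [IsStrictOrderedRing 𝕜] [AddCommGroup V] [Module 𝕜 V] {J : V →ₗ[𝕜] V}
    (hJ : ∀ X, J (J X) = -X) : Even (Module.finrank 𝕜 V) := by
  have hJJ : J * J = (-1 : 𝕜) • 1 := by
    ext X
    simp [hJ]
  have hdet : LinearMap.det J * LinearMap.det J = (-1) ^ Module.finrank 𝕜 V := by
    rw [← map_mul, hJJ, LinearMap.det_smul, map_one, mul_one]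
  by_contra hodd
  rw [(Nat.not_even_iff_odd.1 hodd).neg_one_pow] at hdet
  linarith [mul_self_nonneg (LinearMap.det J)]

/-! ### The Gauss equation -/

open Filter Topology

section Calculus

variable {𝕜 E M N P : Type*} [NontriviallyNormedField 𝕜] [NormedAddCommGroup E] [NormedSpace 𝕜 E]
  [NormedAddCommGroup M] [NormedSpace 𝕜 M] [NormedAddCommGroup N] [NormedSpace 𝕜 N]
  [NormedAddCommGroup P] [NormedSpace 𝕜 P] {A : E → M →L[𝕜] N →L[𝕜] P} {f : E → M} {g : E → N}
  {y : E}

theorem fderiv_clm_apply_apply (hA : DifferentiableAt 𝕜 A y) (hf : DifferentiableAt 𝕜 f y)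
    (hg : DifferentiableAt 𝕜 g y) (u : E) :
    fderiv 𝕜 (fun z ↦ A z (f z) (g z)) y u =
      fderiv 𝕜 A y u (f y) (g y) + A y (fderiv 𝕜 f y u) (g y) + A y (f y) (fderiv 𝕜 g y u) := by
  rw [fderiv_clm_apply (hA.clm_apply hf) hg, fderiv_clm_apply hA hf]
  simp only [add_apply, ContinuousLinearMap.comp_apply, ContinuousLinearMap.flip_apply]
  abel

theorem fderiv_clm_apply_apply_const (hA : DifferentiableAt 𝕜 A y) (m : M) (n : N) (u : E) :
    fderiv 𝕜 (fun z ↦ A z m n) y u = fderiv 𝕜 A y u m n := by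
  simp [fderiv_clm_apply_apply hA (differentiableAt_const m) (differentiableAt_const n)]

end Calculus

section Christoffel

variable {E : Type*} [NormedAddCommGroup E] [NormedSpace ℝ E] {G : E → E →L[ℝ] E →L[ℝ] ℝ} {y : E}

theorem isInvertible_of_pos [FiniteDimensional ℝ E] {T : E →L[ℝ] E →L[ℝ] ℝ}
    (hT : ∀ u, u ≠ 0 → 0 < T u u) : T.IsInvertible := by
  have hinj : Function.Injective T := by
    refine (injective_iff_map_eq_zero T).2 fun u hu ↦ ?_
    by_contra h
    simpa [hu] using hT u h
  have hdim : Module.finrank ℝ E = Module.finrank ℝ (E →L[ℝ] ℝ) := by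
    rw [← LinearEquiv.finrank_eq (LinearMap.toContinuousLinearMap (𝕜 := ℝ) (E := E) (F' := ℝ))]
    exact Subspace.dual_finrank_eq.symm
  exact ⟨(LinearEquiv.ofInjectiveOfFinrankEq (T : E →ₗ[ℝ] E →L[ℝ] ℝ) hinj
    hdim).toContinuousLinearEquiv, rfl⟩

theorem eventually_isInvertible [CompleteSpace E] (hG : ContinuousAt G y)
    (hinv : (G y).IsInvertible) : ∀ᶠ z in 𝓝 y, (G z).IsInvertible :=
  hG.eventually ((ContinuousLinearEquiv.isOpen (𝕜 := ℝ) (E := E) (F := E →L[ℝ] ℝ)).mem_nhds hinv)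

theorem koszul_congr {G' : E → E →L[ℝ] E →L[ℝ] ℝ} (h : G =ᶠ[𝓝 y] G') :
    koszul G y = koszul G' y := by
  ext u v w
  simp only [koszul_apply, h.fderiv_eq]

theorem contDiffAt_koszul {m k : ℕ∞ω} (hG : ContDiffAt ℝ k G y) (hm : m + 1 ≤ k) :
    ContDiffAt ℝ m (koszul G) y := by
  have hD : ContDiffAt ℝ m (fderiv ℝ G) y := hG.fderiv_right hm
  have hflip : ContDiffAt ℝ m (fun z ↦ (fderiv ℝ G z).flip) y :=
    (ContinuousLinearMap.flipₗᵢ ℝ E E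
      (E →L[ℝ] ℝ)).toContinuousLinearEquiv.contDiff.contDiffAt.comp y hD
  exact ((hD.add hflip).sub (contDiffAt_const.clm_comp hflip)).const_smul (1 / 2 : ℝ)

theorem apply_christoffel (hG : (G y).IsInvertible) (u v w : E) :
    G y (christoffel G y u v) w = koszul G y u v w := by
  rw [christoffel_apply, hG.self_apply_inverse]

theorem contDiffAt_christoffel [CompleteSpace E] {m k : ℕ∞ω} (hG : ContDiffAt ℝ k G y)
    (hinv : (G y).IsInvertible) (hm : m + 1 ≤ k) : ContDiffAt ℝ m (christoffel G) y := by
  have hinverse : ContDiffAt ℝ m (fun z ↦ (G z).inverse) y :=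
    hinv.contDiffAt_map_inverse.comp y (hG.of_le (le_self_add.trans hm))
  have hkoszul := contDiffAt_koszul hG hm
  unfold christoffel
  fun_prop

theorem differentiableAt_christoffel [CompleteSpace E] (hG : ContDiffAt ℝ 2 G y)
    (hinv : (G y).IsInvertible) : DifferentiableAt ℝ (christoffel G) y :=
  (contDiffAt_christoffel (m := 1) hG hinv (by norm_num)).differentiableAt one_ne_zero

theorem apply_fderiv_christoffel [CompleteSpace E] (hG : ContDiffAt ℝ 2 G y)
    (hinv : (G y).IsInvertible) (u v w t : E) :
    G y (fderiv ℝ (christoffel G) y u v w) t =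
      fderiv ℝ (fun z ↦ koszul G z v w t) y u - fderiv ℝ G y u (christoffel G y v w) t := by
  have hΓ := differentiableAt_christoffel hG hinv
  have hkoszul : (fun z ↦ koszul G z v w t) =ᶠ[𝓝 y] fun z ↦ G z (christoffel G z v w) t :=
    (eventually_isInvertible hG.continuousAt hinv).mono fun z hz ↦ (apply_christoffel hz v w t).symm
  have hΓvw : DifferentiableAt ℝ (fun z ↦ christoffel G z v w) y := by fun_prop
  rw [hkoszul.fderiv_eq, fderiv_clm_apply_apply (hG.differentiableAt two_ne_zero) hΓvw
    (differentiableAt_const t), fderiv_clm_apply_apply_const hΓ]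
  simp

/-- The second covariant derivative `(∇_u ∇_v w)(y)` for constant vector fields `v` and `w`. -/
def secondCovDeriv (G : E → E →L[ℝ] E →L[ℝ] ℝ) (y u v w : E) : E :=
  fderiv ℝ (christoffel G) y u v w + christoffel G y u (christoffel G y v w)

theorem localCurvature_eq_sub (G : E → E →L[ℝ] E →L[ℝ] ℝ) (y u v w : E) :
    localCurvature G y u v w = secondCovDeriv G y u v w - secondCovDeriv G y v u w := by
  rw [localCurvature, secondCovDeriv, secondCovDeriv]
  abel

theorem fderiv_localCovDerivEnd {J : E → E →L[ℝ] E} (hΓ : DifferentiableAt ℝ (christoffel G) y)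
    (hJ : ContDiffAt ℝ 2 J y) (u v w : E) :
    fderiv ℝ (fun z ↦ localCovDerivEnd G J z v w) y u =
      fderiv ℝ (fderiv ℝ J) y u v w +
        (fderiv ℝ (christoffel G) y u v (J y w) + christoffel G y v (fderiv ℝ J y u w)) -
        (fderiv ℝ J y u (christoffel G y v w) + J y (fderiv ℝ (christoffel G) y u v w)) := by
  have hDJ : DifferentiableAt ℝ (fderiv ℝ J) y :=
    (hJ.fderiv_right (m := 1) (by norm_num)).differentiableAt one_ne_zero
  have hJy : DifferentiableAt ℝ J y := hJ.differentiableAt two_ne_zero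
  have hJw : DifferentiableAt ℝ (fun z ↦ J z w) y := by fun_prop
  have hΓvw : DifferentiableAt ℝ (fun z ↦ christoffel G z v w) y := by fun_prop
  unfold localCovDerivEnd
  rw [fderiv_fun_sub (by fun_prop) (by fun_prop), fderiv_fun_add (by fun_prop) (by fun_prop),
    sub_apply, add_apply, fderiv_clm_apply_apply_const hDJ,
    fderiv_clm_apply_apply hΓ (differentiableAt_const v) hJw, fderiv_clm_apply hJy hΓvw,
    fderiv_clm_apply hJy (differentiableAt_const w)]
  simp [fderiv_clm_apply_apply_const hΓ, add_comm]

theorem localCurvature_apply_parallel {J : E → E →L[ℝ] E}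
    (hΓ : DifferentiableAt ℝ (christoffel G) y) (hJ : ContDiffAt ℝ 2 J y)
    (hpar : ∀ᶠ z in 𝓝 y, ∀ u v, localCovDerivEnd G J z u v = 0) (u v w : E) :
    localCurvature G y u v (J y w) = J y (localCurvature G y u v w) := by
  have hDJ (u x : E) :
      fderiv ℝ J y u x = J y (christoffel G y u x) - christoffel G y u (J y x) := by
    have hux := hpar.self_of_nhds u x
    rw [localCovDerivEnd, sub_eq_zero] at hux
    rw [← hux, add_sub_cancel_right]
  have hD2J (u v : E) : fderiv ℝ (fderiv ℝ J) y u v w =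
      J y (secondCovDeriv G y u v w) -
        (fderiv ℝ (christoffel G) y u v (J y w) - christoffel G y v (christoffel G y u (J y w))) -
        (christoffel G y u (J y (christoffel G y v w)) +
          christoffel G y v (J y (christoffel G y u w))) := by
    have hzero : fderiv ℝ (fun z ↦ localCovDerivEnd G J z v w) y u = 0 := by
      rw [EventuallyEq.fderiv_eq (f := fun _ ↦ 0) (hpar.mono fun z hz ↦ hz v w)]
      simp
    rw [fderiv_localCovDerivEnd hΓ hJ, hDJ, hDJ, map_sub] at hzero
    rw [secondCovDeriv, map_add, ← sub_eq_zero, ← hzero]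
    abel
  have hsymm : fderiv ℝ (fderiv ℝ J) y u v w = fderiv ℝ (fderiv ℝ J) y v u w :=
    congrArg (· w) (hJ.isSymmSndFDerivAt (by simp) u v)
  rw [hD2J, hD2J, ← sub_eq_zero] at hsymm
  rw [← sub_eq_zero, ← neg_eq_zero, ← hsymm, localCurvature_eq_sub G y u v w, map_sub,
    localCurvature]
  abel

end Christoffel

section Gauss

variable {E L : Type*} [NormedAddCommGroup E] [NormedSpace ℝ E]
  [NormedAddCommGroup L] [NormedSpace ℝ L]

/-- The field of bilinear forms induced by a map `F` and a bilinear form `Λ` on its target. -/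
def pullbackForm (Λ : L →L[ℝ] L →L[ℝ] ℝ) (F : E → L) (y : E) : E →L[ℝ] E →L[ℝ] ℝ :=
  Λ.bilinearComp (fderiv ℝ F y) (fderiv ℝ F y)

@[simp]
theorem pullbackForm_apply (Λ : L →L[ℝ] L →L[ℝ] ℝ) (F : E → L) (y u v : E) :
    pullbackForm Λ F y u v = Λ (fderiv ℝ F y u) (fderiv ℝ F y v) := rfl

variable {Λ : L →L[ℝ] L →L[ℝ] ℝ} {F : E → L} {G : E → E →L[ℝ] E →L[ℝ] ℝ} {y : E}

theorem contDiffAt_pullbackForm {m k : ℕ∞ω} (hF : ContDiffAt ℝ k F y) (hm : m + 1 ≤ k) :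
    ContDiffAt ℝ m (pullbackForm Λ F) y := by
  have hD := hF.fderiv_right hm
  have heq : pullbackForm Λ F = fun z ↦
      ((ContinuousLinearMap.compL ℝ E L ℝ).flip (fderiv ℝ F z)) ∘L (Λ ∘L fderiv ℝ F z) := rfl
  rw [heq]
  fun_prop

theorem fderiv_apply_fderiv_apply {H : E → L} (hH : DifferentiableAt ℝ H y)
    (hF : DifferentiableAt ℝ (fderiv ℝ F) y) (u w : E) :
    fderiv ℝ (fun z ↦ Λ (H z) (fderiv ℝ F z w)) y u =
      Λ (fderiv ℝ H y u) (fderiv ℝ F y w) + Λ (H y) (fderiv ℝ (fderiv ℝ F) y u w) := by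
  have hFw : DifferentiableAt ℝ (fun z ↦ fderiv ℝ F z w) y := by fun_prop
  rw [fderiv_clm_apply_apply (differentiableAt_const Λ) hH hFw,
    fderiv_clm_apply hF (differentiableAt_const w)]
  simp

theorem fderiv_pullbackForm (hF : ContDiffAt ℝ 2 F y) (u v w : E) :
    fderiv ℝ (pullbackForm Λ F) y u v w =
      Λ (fderiv ℝ (fderiv ℝ F) y u v) (fderiv ℝ F y w) +
        Λ (fderiv ℝ F y v) (fderiv ℝ (fderiv ℝ F) y u w) := by
  have hform : DifferentiableAt ℝ (pullbackForm Λ F) y :=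
    (contDiffAt_pullbackForm (m := 1) hF (by norm_num)).differentiableAt one_ne_zero
  have hDF : DifferentiableAt ℝ (fderiv ℝ F) y :=
    (hF.fderiv_right (m := 1) (by norm_num)).differentiableAt one_ne_zero
  rw [← fderiv_clm_apply_apply_const hform]
  simp only [pullbackForm_apply]
  rw [fderiv_apply_fderiv_apply (by fun_prop) hDF, fderiv_clm_apply hDF (differentiableAt_const v)]
  simp

theorem koszul_pullbackForm (hΛ : ∀ a b, Λ a b = Λ b a) (hF : ContDiffAt ℝ 2 F y) (u v w : E) :
    koszul (pullbackForm Λ F) y u v w = Λ (fderiv ℝ (fderiv ℝ F) y u v) (fderiv ℝ F y w) := by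
  have hsymm (a b : E) : fderiv ℝ (fderiv ℝ F) y a b = fderiv ℝ (fderiv ℝ F) y b a :=
    (hF.isSymmSndFDerivAt (by simp)) a b
  simp only [koszul_apply, fderiv_pullbackForm hF, hsymm v u, hsymm w u, hsymm w v]
  rw [hΛ (fderiv ℝ F y v), hΛ (fderiv ℝ F y u) (fderiv ℝ (fderiv ℝ F) y v w)]
  ring

theorem form_fderiv_apply_self {c : ℝ} (hΛ : ∀ a b, Λ a b = Λ b a) (hF : DifferentiableAt ℝ F y)
    (hc : ∀ᶠ z in 𝓝 y, Λ (F z) (F z) = c) (u : E) : Λ (fderiv ℝ F y u) (F y) = 0 := by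
  have hD : fderiv ℝ (fun z ↦ Λ (F z) (F z)) y u = 0 := by
    rw [EventuallyEq.fderiv_eq (f := fun _ ↦ c) hc]
    simp
  rw [fderiv_clm_apply_apply (differentiableAt_const Λ) hF hF, hΛ (F y)] at hD
  simp only [fderiv_fun_const, Pi.zero_apply, zero_apply, zero_add] at hD
  linarith

/-- The second fundamental form of a map `F` for the metric `G`, i.e. the Hessian of `F`. -/
def hessian (G : E → E →L[ℝ] E →L[ℝ] ℝ) (F : E → L) (y : E) : E →L[ℝ] E →L[ℝ] L :=
  fderiv ℝ (fderiv ℝ F) y - (ContinuousLinearMap.compL ℝ E E L (fderiv ℝ F y)) ∘L christoffel G y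

@[simp]
theorem hessian_apply (G : E → E →L[ℝ] E →L[ℝ] ℝ) (F : E → L) (y u v : E) :
    hessian G F y u v = fderiv ℝ (fderiv ℝ F) y u v - fderiv ℝ F y (christoffel G y u v) := rfl

/-- `F` is, around `y`, an immersion which induces the metric `G`. -/
structure IsLocalImmersion (Λ : L →L[ℝ] L →L[ℝ] ℝ) (F : E → L) (G : E → E →L[ℝ] E →L[ℝ] ℝ)
    (y : E) : Prop where
  form_symm : ∀ a b, Λ a b = Λ b a
  contDiffAt : ContDiffAt ℝ 3 F y
  metric_eq : G =ᶠ[𝓝 y] pullbackForm Λ F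
  metric_pos : ∀ u, u ≠ 0 → 0 < G y u u

namespace IsLocalImmersion

theorem metric_apply (H : IsLocalImmersion Λ F G y) (u v : E) :
    G y u v = Λ (fderiv ℝ F y u) (fderiv ℝ F y v) := by
  rw [H.metric_eq.eq_of_nhds, pullbackForm_apply]

theorem contDiffAt_metric (H : IsLocalImmersion Λ F G y) : ContDiffAt ℝ 2 G y :=
  (contDiffAt_pullbackForm H.contDiffAt (by norm_num)).congr_of_eventuallyEq H.metric_eq

theorem contDiffAt_fderiv (H : IsLocalImmersion Λ F G y) : ContDiffAt ℝ 2 (fderiv ℝ F) y :=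
  H.contDiffAt.fderiv_right (by norm_num)

theorem differentiableAt_fderiv (H : IsLocalImmersion Λ F G y) :
    DifferentiableAt ℝ (fderiv ℝ F) y :=
  H.contDiffAt_fderiv.differentiableAt two_ne_zero

theorem differentiableAt_fderiv_fderiv (H : IsLocalImmersion Λ F G y) :
    DifferentiableAt ℝ (fderiv ℝ (fderiv ℝ F)) y :=
  (H.contDiffAt_fderiv.fderiv_right (m := 1) (by norm_num)).differentiableAt one_ne_zero

theorem eventually_koszul_eq (H : IsLocalImmersion Λ F G y) :
    ∀ᶠ z in 𝓝 y, ∀ u v w,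
      koszul G z u v w = Λ (fderiv ℝ (fderiv ℝ F) z u v) (fderiv ℝ F z w) := by
  filter_upwards [H.metric_eq.eventually_nhds, H.contDiffAt.eventually (by simp)]
    with z hGz hFz u v w
  rw [koszul_congr hGz, koszul_pullbackForm H.form_symm (hFz.of_le (by norm_num))]

theorem fderiv_fderiv_symm (H : IsLocalImmersion Λ F G y) (u v : E) :
    fderiv ℝ (fderiv ℝ F) y u v = fderiv ℝ (fderiv ℝ F) y v u :=
  (H.contDiffAt.isSymmSndFDerivAt (by simp; norm_num)) u v

theorem form_apply_fderiv_self (H : IsLocalImmersion Λ F G y) {c : ℝ}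
    (hc : ∀ᶠ z in 𝓝 y, Λ (F z) (F z) = c) (u : E) : Λ (F y) (fderiv ℝ F y u) = 0 := by
  rw [H.form_symm, form_fderiv_apply_self H.form_symm (H.contDiffAt.differentiableAt (by simp)) hc]

theorem form_hessian_self (H : IsLocalImmersion Λ F G y) {c : ℝ}
    (hc : ∀ᶠ z in 𝓝 y, Λ (F z) (F z) = c) (u v : E) : Λ (hessian G F y u v) (F y) = -G y u v := by
  have horth : ∀ᶠ z in 𝓝 y, ∀ u, Λ (F z) (fderiv ℝ F z u) = 0 := by
    filter_upwards [hc.eventually_nhds, H.contDiffAt.eventually (by simp)] with z hz hFz u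
    rw [H.form_symm, form_fderiv_apply_self H.form_symm (hFz.differentiableAt (by simp)) hz]
  have hD : fderiv ℝ (fun z ↦ Λ (F z) (fderiv ℝ F z v)) y u = 0 := by
    rw [EventuallyEq.fderiv_eq (f := fun _ ↦ 0) (horth.mono fun z hz ↦ hz v)]
    simp
  rw [fderiv_apply_fderiv_apply (H.contDiffAt.differentiableAt (by simp))
    H.differentiableAt_fderiv, ← H.metric_apply, H.form_symm (F y)] at hD
  rw [hessian_apply, map_sub, sub_apply, H.form_symm (fderiv ℝ F y _),
    H.form_apply_fderiv_self hc, sub_zero]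
  linarith

variable [FiniteDimensional ℝ E]

theorem isInvertible (H : IsLocalImmersion Λ F G y) : (G y).IsInvertible :=
  isInvertible_of_pos H.metric_pos

theorem metric_christoffel (H : IsLocalImmersion Λ F G y) (u v w : E) :
    G y (christoffel G y u v) w = Λ (fderiv ℝ (fderiv ℝ F) y u v) (fderiv ℝ F y w) := by
  rw [apply_christoffel H.isInvertible, H.eventually_koszul_eq.self_of_nhds]

theorem christoffel_symm (H : IsLocalImmersion Λ F G y) (u v : E) :
    christoffel G y u v = christoffel G y v u := by
  refine H.isInvertible.injective (ContinuousLinearMap.ext fun w ↦ ?_)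
  rw [H.metric_christoffel, H.metric_christoffel, H.fderiv_fderiv_symm]

theorem hessian_symm (H : IsLocalImmersion Λ F G y) (u v : E) :
    hessian G F y u v = hessian G F y v u := by
  rw [hessian_apply, hessian_apply, H.christoffel_symm, H.fderiv_fderiv_symm]

theorem form_hessian_fderiv (H : IsLocalImmersion Λ F G y) (u v w : E) :
    Λ (hessian G F y u v) (fderiv ℝ F y w) = 0 := by
  rw [hessian_apply, map_sub, sub_apply, ← H.metric_christoffel, H.metric_apply, sub_self]

theorem form_hessian_hessian (H : IsLocalImmersion Λ F G y) (u v w t : E) :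
    Λ (hessian G F y u v) (hessian G F y w t) =
      Λ (hessian G F y u v) (fderiv ℝ (fderiv ℝ F) y w t) := by
  rw [hessian_apply G F y w t, map_sub, H.form_hessian_fderiv, sub_zero]

theorem metric_secondCovDeriv (H : IsLocalImmersion Λ F G y) (u v w t : E) :
    G y (secondCovDeriv G y u v w) t =
      Λ (fderiv ℝ (fderiv ℝ (fderiv ℝ F)) y u v w) (fderiv ℝ F y t) +
        Λ (hessian G F y v w) (hessian G F y u t) := by
  have hkoszul : fderiv ℝ (fun z ↦ koszul G z v w t) y u =
      Λ (fderiv ℝ (fderiv ℝ (fderiv ℝ F)) y u v w) (fderiv ℝ F y t) +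
        Λ (fderiv ℝ (fderiv ℝ F) y v w) (fderiv ℝ (fderiv ℝ F) y u t) := by
    have hF := H.differentiableAt_fderiv_fderiv
    rw [EventuallyEq.fderiv_eq (H.eventually_koszul_eq.mono fun z hz ↦ hz v w t),
      fderiv_apply_fderiv_apply (by fun_prop) H.differentiableAt_fderiv,
      fderiv_clm_apply_apply_const hF]
  have hmetric : fderiv ℝ G y u (christoffel G y v w) t =
      Λ (fderiv ℝ (fderiv ℝ F) y u (christoffel G y v w)) (fderiv ℝ F y t) +
        Λ (fderiv ℝ F y (christoffel G y v w)) (fderiv ℝ (fderiv ℝ F) y u t) := by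
    rw [H.metric_eq.fderiv_eq, fderiv_pullbackForm (H.contDiffAt.of_le (by norm_num))]
  rw [secondCovDeriv, map_add, add_apply,
    apply_fderiv_christoffel H.contDiffAt_metric H.isInvertible, hkoszul, hmetric,
    H.metric_christoffel, H.form_hessian_hessian, hessian_apply, map_sub, sub_apply]
  ring

theorem metric_localCurvature (H : IsLocalImmersion Λ F G y) (u v w t : E) :
    G y (localCurvature G y u v w) t =
      Λ (hessian G F y u t) (hessian G F y v w) - Λ (hessian G F y u w) (hessian G F y v t) := by
  have hsymm : fderiv ℝ (fderiv ℝ (fderiv ℝ F)) y u v = fderiv ℝ (fderiv ℝ (fderiv ℝ F)) y v u :=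
    H.contDiffAt_fderiv.isSymmSndFDerivAt (by simp) u v
  rw [localCurvature_eq_sub, map_sub, sub_apply, H.metric_secondCovDeriv, H.metric_secondCovDeriv,
    hsymm, H.form_symm (hessian G F y u t)]
  ring

end IsLocalImmersion

end Gauss

/-! ### The estimate at a point -/

section LocalEstimate

variable {E L : Type*} [NormedAddCommGroup E] [NormedSpace ℝ E] [NormedAddCommGroup L]
  [NormedSpace ℝ L] {Λ : L →L[ℝ] L →L[ℝ] ℝ} {F : E → L} {G : E → E →L[ℝ] E →L[ℝ] ℝ}
  {J : E → E →L[ℝ] E} {y : E}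

/-- `(G, J)` satisfies, around `y`, the equations of a Kaehler structure. -/
structure IsLocalKaehler (G : E → E →L[ℝ] E →L[ℝ] ℝ) (J : E → E →L[ℝ] E) (y : E) : Prop where
  contDiffAt_J : ContDiffAt ℝ 2 J y
  J_J : ∀ u, J y (J y u) = -u
  metric_J : ∀ u v, G y (J y u) (J y v) = G y u v
  parallel : ∀ᶠ z in 𝓝 y, ∀ u v, localCovDerivEnd G J z u v = 0

/-- The normal space of the map `F` at `y`, for the form `Λ`. -/
def normalSpace (Λ : L →L[ℝ] L →L[ℝ] ℝ) (F : E → L) (y : E) : Submodule ℝ L :=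
  LinearMap.BilinForm.orthogonal Λ.toLinearMap₁₂ (LinearMap.range (fderiv ℝ F y).toLinearMap)

/-- The form induced by `Λ` on the normal space. -/
def normalForm (Λ : L →L[ℝ] L →L[ℝ] ℝ) (F : E → L) (y : E) :
    LinearMap.BilinForm ℝ (normalSpace Λ F y) :=
  LinearMap.BilinForm.restrict Λ.toLinearMap₁₂ (normalSpace Λ F y)

namespace IsLocalImmersion

theorem mem_normalSpace (H : IsLocalImmersion Λ F G y) {w : L} :
    w ∈ normalSpace Λ F y ↔ ∀ u, Λ w (fderiv ℝ F y u) = 0 := by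
  simp only [H.form_symm w]
  exact ⟨fun hw u ↦ hw _ ⟨u, rfl⟩, fun hw _ ⟨u, hu⟩ ↦ hu ▸ hw u⟩

theorem injective_fderiv (H : IsLocalImmersion Λ F G y) : Function.Injective (fderiv ℝ F y) := by
  refine (injective_iff_map_eq_zero _).2 fun u hu ↦ ?_
  by_contra hne
  simpa [H.metric_apply, hu] using H.metric_pos u hne

theorem finrank_normalSpace [FiniteDimensional ℝ L] (H : IsLocalImmersion Λ F G y)
    (hΛ : Λ.toLinearMap₁₂.Nondegenerate) :
    Module.finrank ℝ E + Module.finrank ℝ (normalSpace Λ F y) = Module.finrank ℝ L := by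
  have hrange : Module.finrank ℝ (LinearMap.range (fderiv ℝ F y).toLinearMap) =
      Module.finrank ℝ E := LinearMap.finrank_range_of_inj H.injective_fderiv
  rw [normalSpace, LinearMap.BilinForm.finrank_orthogonal hΛ, hrange]
  exact Nat.add_sub_cancel' (hrange ▸ Submodule.finrank_le _)

variable [FiniteDimensional ℝ E]

/-- The second fundamental form with values in the normal space. -/
def secondFundamentalForm (H : IsLocalImmersion Λ F G y) : E →ₗ[ℝ] E →ₗ[ℝ] normalSpace Λ F y :=
  LinearMap.mk₂ ℝ
    (fun u v ↦ ⟨hessian G F y u v, H.mem_normalSpace.2 (H.form_hessian_fderiv u v)⟩)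
    (fun _ _ _ ↦ Subtype.ext (by simp only [map_add, add_apply, Submodule.coe_add]))
    (fun _ _ _ ↦ Subtype.ext (by simp only [map_smul, smul_apply, Submodule.coe_smul]))
    (fun _ _ _ ↦ Subtype.ext (by simp only [map_add, Submodule.coe_add]))
    (fun _ _ _ ↦ Subtype.ext (by simp only [map_smul, Submodule.coe_smul]))

theorem metric_localCurvature_eq_gaussForm (H : IsLocalImmersion Λ F G y) (u v w t : E) :
    G y (localCurvature G y u v w) t =
      gaussForm (normalForm Λ F y) H.secondFundamentalForm u v w t :=
  H.metric_localCurvature u v w t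

theorem isKaehlerSecondForm (H : IsLocalImmersion Λ F G y) (K : IsLocalKaehler G J y)
    (hF : ∀ᶠ z in 𝓝 y, Λ (F z) (F z) = -1) (hpos : ∀ w, Λ w (F y) = 0 → w ≠ 0 → 0 < Λ w w) :
    IsKaehlerSecondForm (J y).toLinearMap (G y).toLinearMap₁₂ (normalForm Λ F y)
      ⟨F y, H.mem_normalSpace.2 (H.form_apply_fderiv_self hF)⟩ H.secondFundamentalForm where
  J_J := K.J_J
  metric_symm u v := by
    change G y u v = G y v u
    rw [H.metric_apply, H.metric_apply, H.form_symm]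
  metric_pos := H.metric_pos
  metric_J := K.metric_J
  form_symm v w := H.form_symm v w
  form_self := hF.self_of_nhds
  form_pos w hw hne := hpos w hw (by simpa using hne)
  symm u v := Subtype.ext (H.hessian_symm u v)
  apply_f := H.form_hessian_self hF
  kaehler u v w t := by
    have hΓ := differentiableAt_christoffel H.contDiffAt_metric H.isInvertible
    simp only [← H.metric_localCurvature_eq_gaussForm, ContinuousLinearMap.coe_coe]
    rw [localCurvature_apply_parallel hΓ K.contDiffAt_J K.parallel, K.metric_J]

theorem exists_subspace [FiniteDimensional ℝ L] (H : IsLocalImmersion Λ F G y)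
    (K : IsLocalKaehler G J y) (hF : ∀ᶠ z in 𝓝 y, Λ (F z) (F z) = -1)
    (hpos : ∀ w, Λ w (F y) = 0 → w ≠ 0 → 0 < Λ w w)
    (hdim : 2 * Module.finrank ℝ L < 3 * Module.finrank ℝ E) :
    ∃ S : Submodule ℝ E, (∀ X ∈ S, J y X ∈ S) ∧
      3 * Module.finrank ℝ E + 4 ≤ Module.finrank ℝ S + 2 * Module.finrank ℝ L ∧
      ∀ X ∈ S, G y (localCurvature G y X (J y X) (J y X)) X ≤ 0 ∧
        ∀ A : E →ₗ[ℝ] E, (∀ Z, A Z = localCurvature G y Z X X) → LinearMap.trace ℝ E A ≤ 0 := by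
  have hnormal := H.finrank_normalSpace (nondegenerate_of_orthogonal_pos H.form_symm hpos)
  have hK := H.isKaehlerSecondForm K hF hpos
  obtain ⟨v, hv⟩ := hK.exists_isNullNormal (by omega)
  obtain ⟨S, hSJ, hS, hSv⟩ := hK.exists_subspace hv
  refine ⟨S, hSJ, by omega, fun X hX ↦ ⟨?_, fun A hA ↦ ?_⟩⟩
  · rw [H.metric_localCurvature_eq_gaussForm]
    exact hK.gaussForm_apply_J_self_nonpos hv (hSv X hX)
  · refine hK.trace_nonpos hv (hSv X hX) fun Z T ↦ ?_
    rw [hA]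
    exact H.metric_localCurvature_eq_gaussForm Z X X T

end IsLocalImmersion

end LocalEstimate

section Lorentz

variable {N : ℕ}

/-- The Lorentzian inner product as a continuous bilinear form. -/
def lorentzForm (N : ℕ) : LorentzSpace N →L[ℝ] LorentzSpace N →L[ℝ] ℝ :=
  (innerSL ℝ).bilinearComp (.snd ℝ ℝ (EuclideanSpace ℝ (Fin N))) (.snd ℝ ℝ _) -
    (ContinuousLinearMap.mul ℝ ℝ).bilinearComp (.fst ℝ ℝ _) (.fst ℝ ℝ _)

theorem lorentzForm_apply (a b : LorentzSpace N) : lorentzForm N a b = lorentz a b := rfl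

theorem lorentz_comm (a b : LorentzSpace N) : lorentz a b = lorentz b a := by
  simp only [lorentz, real_inner_comm, mul_comm]

theorem lorentz_pos_of_orthogonal {a w : LorentzSpace N} (ha : lorentz a a = -1)
    (hw : lorentz w a = 0) (hne : w ≠ 0) : 0 < lorentz w w := by
  obtain ⟨t, x⟩ := a
  obtain ⟨s, z⟩ := w
  simp only [lorentz, real_inner_self_eq_norm_sq, sub_eq_zero] at ha hw ⊢
  have hz : z ≠ 0 := by
    rintro rfl
    have hs : s = 0 := by
      rw [inner_zero_left, eq_comm, mul_eq_zero] at hw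
      exact hw.resolve_right fun ht ↦ by nlinarith [sq_nonneg ‖x‖]
    exact hne (by rw [hs, Prod.mk_zero_zero])
  have hcs : inner ℝ z x ^ 2 ≤ ‖z‖ ^ 2 * ‖x‖ ^ 2 := by
    rw [← mul_pow]
    exact sq_le_sq' (by linarith [neg_le_of_abs_le (abs_real_inner_le_norm z x)])
      (real_inner_le_norm z x)
  have hle : ‖z‖ ^ 2 ≤ t ^ 2 * (‖z‖ ^ 2 - s * s) := by
    rw [hw] at hcs
    linear_combination hcs + ‖z‖ ^ 2 * ha
  exact pos_of_mul_pos_right ((pow_pos (norm_pos_iff.2 hz) 2).trans_le hle) (sq_nonneg t)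

theorem finrank_lorentzSpace (N : ℕ) : Module.finrank ℝ (LorentzSpace N) = N + 1 := by
  rw [Module.finrank_prod, Module.finrank_self, finrank_euclideanSpace_fin, add_comm]

end Lorentz

/-! ### Preferred charts -/

section Chart

variable {n : ℕ} {M : Type*} [TopologicalSpace M] [ChartedSpace (Model n) M]

theorem extChartAt_target_mem_nhds_self (x : M) :
    (extChartAt 𝓘(ℝ, Model n) x).target ∈ 𝓝 (extChartAt 𝓘(ℝ, Model n) x x) :=
  (isOpen_extChartAt_target x).mem_nhds (mem_extChartAt_target x)

theorem chartSymmDeriv_eq_mfderivWithin (x₀ : M) (y : Model n) :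
    chartSymmDeriv x₀ y = mfderivWithin 𝓘(ℝ, Model n) 𝓘(ℝ, Model n)
      (extChartAt 𝓘(ℝ, Model n) x₀).symm (Set.range 𝓘(ℝ, Model n)) y := by
  rw [chartSymmDeriv, ← mfderivWithin_univ, modelWithCornersSelf_coe, Set.range_id]

variable [IsManifold 𝓘(ℝ, Model n) ∞ M]

theorem contMDiffAt_extChartAt_symm (x : M) {y : Model n}
    (hy : y ∈ (extChartAt 𝓘(ℝ, Model n) x).target) :
    ContMDiffAt 𝓘(ℝ, Model n) 𝓘(ℝ, Model n) ∞ (extChartAt 𝓘(ℝ, Model n) x).symm y :=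
  (contMDiffOn_extChartAt_symm x).contMDiffAt ((isOpen_extChartAt_target x).mem_nhds hy)

theorem chartSymmDeriv_self (x : M) (u : Model n) :
    (chartSymmDeriv x (extChartAt 𝓘(ℝ, Model n) x x) u : Model n) = u := by
  have : IsManifold 𝓘(ℝ, Model n) 1 M := .of_le (n := ∞) (by simp)
  rw [chartSymmDeriv_eq_mfderivWithin]
  exact congrArg (fun T : Model n →L[ℝ] Model n ↦ T u)
    (mfderivWithin_range_extChartAt_symm (I := 𝓘(ℝ, Model n)) (x := x))

theorem chartMetric_self (g : RiemannianMetric n M) (x : M) :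
    chartMetric g x (extChartAt 𝓘(ℝ, Model n) x x) = g.inner x := by
  ext u v
  have htransport (x' : M) (a b : Model n) (hx : x' = x) (ha : a = u) (hb : b = v) :
      (g.inner x' : Model n →L[ℝ] Model n →L[ℝ] ℝ) a b = g.inner x u v := by
    subst hx ha hb
    rfl
  exact htransport _ _ _ (extChartAt_to_inv x) (chartSymmDeriv_self x u) (chartSymmDeriv_self x v)

theorem chartEnd_self
    (J : ∀ x : M, TangentSpace 𝓘(ℝ, Model n) x →L[ℝ] TangentSpace 𝓘(ℝ, Model n) x)
    (x : M) : chartEnd J x (extChartAt 𝓘(ℝ, Model n) x x) = J x := by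
  refine ContinuousLinearMap.ext fun u ↦ ?_
  have : IsManifold 𝓘(ℝ, Model n) 1 M := .of_le (n := ∞) (by simp)
  have hderiv (x' : M) (hx : x' = x) (w : Model n) :
      (mfderiv 𝓘(ℝ, Model n) 𝓘(ℝ, Model n) (extChartAt 𝓘(ℝ, Model n) x) x' :
        Model n →L[ℝ] Model n) w = w := by
    subst hx
    exact congrArg (fun T : Model n →L[ℝ] Model n ↦ T w)
      (mfderiv_extChartAt_self (I := 𝓘(ℝ, Model n)))
  have htransport (x' : M) (a : Model n) (hx : x' = x) (ha : a = u) :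
      (J x' : Model n →L[ℝ] Model n) a = J x u := by
    subst hx ha
    rfl
  exact (hderiv _ (extChartAt_to_inv x) _).trans
    (htransport _ _ (extChartAt_to_inv x) (chartSymmDeriv_self x u))

theorem KaehlerStructure.contDiffAt_chartEnd (K : KaehlerStructure n M) (x : M) :
    ContDiffAt ℝ ∞ (chartEnd K.J x) (extChartAt 𝓘(ℝ, Model n) x x) := by
  have : IsManifold 𝓘(ℝ, Model n) 1 M := .of_le (n := ∞) (by simp)
  have hcomp := ContMDiffAt.comp_of_eq ((contMDiffAt_hom_bundle _).1 (K.contMDiff_J x)).2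
    (contMDiffAt_extChartAt_symm x (mem_extChartAt_target x)) (extChartAt_to_inv x)
  refine (contMDiffAt_iff_contDiffAt.1 hcomp).congr_of_eventuallyEq ?_
  filter_upwards [extChartAt_target_mem_nhds_self x] with z hz
  have hz' : (extChartAt 𝓘(ℝ, Model n) x).symm z ∈ (chartAt (Model n) x).source := by
    rw [← extChartAt_source 𝓘(ℝ, Model n)]
    exact (extChartAt 𝓘(ℝ, Model n) x).map_target hz
  simp only [Function.comp_apply, ContinuousLinearMap.inCoordinates]
  rw [TangentBundle.continuousLinearMapAt_trivializationAt hz',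
    TangentBundle.symmL_trivializationAt hz', (extChartAt 𝓘(ℝ, Model n) x).right_inv hz]
  rw [chartEnd, chartSymmDeriv_eq_mfderivWithin, chartDeriv]

theorem KaehlerStructure.isLocalKaehler (K : KaehlerStructure n M) (x : M) :
    IsLocalKaehler (chartMetric K.metric x) (chartEnd K.J x) (extChartAt 𝓘(ℝ, Model n) x x) where
  contDiffAt_J := (K.contDiffAt_chartEnd x).of_le (WithTop.coe_le_coe.2 (le_top (a := 2)))
  J_J u := by
    rw [chartEnd_self]
    exact K.J_J x u
  metric_J u v := by
    rw [chartEnd_self, chartMetric_self]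
    exact K.inner_J_J x u v
  parallel := by
    filter_upwards [extChartAt_target_mem_nhds_self x] with z hz using K.parallel_J x z hz

theorem KaehlerStructure.inner_J_self (K : KaehlerStructure n M) (x : M)
    (S : TangentSpace 𝓘(ℝ, Model n) x) : K.metric.inner x S (K.J x S) = 0 := by
  have hneg := K.inner_J_J x S (K.J x S)
  rw [K.J_J, map_neg, K.metric.symm] at hneg
  linarith

theorem KaehlerStructure.sectionalCurvature_J (K : KaehlerStructure n M) (x : M)
    (S : TangentSpace 𝓘(ℝ, Model n) x) :
    sectionalCurvature K.metric x S (K.J x S) =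
      K.metric.inner x (curvature K.metric x S (K.J x S) (K.J x S)) S /
        K.metric.inner x S S ^ 2 := by
  rw [sectionalCurvature, K.inner_J_self, K.inner_J_J, zero_pow two_ne_zero, sub_zero, sq]

namespace IsIsometricImmersion

variable {N : ℕ}

theorem isLocalImmersion {g : RiemannianMetric n M} {f : M → HyperbolicSpace N}
    (hf : IsIsometricImmersion g f) (x : M) :
    IsLocalImmersion (lorentzForm N)
      (fun z ↦ (f ((extChartAt 𝓘(ℝ, Model n) x).symm z)).incl) (chartMetric g x)
      (extChartAt 𝓘(ℝ, Model n) x x) where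
  form_symm := lorentz_comm
  contDiffAt :=
    (contMDiffAt_iff_contDiffAt.1 ((hf.contMDiff _).comp _
      (contMDiffAt_extChartAt_symm x (mem_extChartAt_target x)))).of_le
      (WithTop.coe_le_coe.2 (le_top (a := 3)))
  metric_eq := by
    filter_upwards [extChartAt_target_mem_nhds_self x] with z hz
    have hchain : fderiv ℝ (fun z ↦ (f ((extChartAt 𝓘(ℝ, Model n) x).symm z)).incl) z =
        (mfderiv 𝓘(ℝ, Model n) 𝓘(ℝ, LorentzSpace N) (fun x ↦ (f x).incl)
          ((extChartAt 𝓘(ℝ, Model n) x).symm z)).comp (chartSymmDeriv x z) := by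
      rw [← mfderiv_eq_fderiv]
      exact mfderiv_comp z ((hf.contMDiff _).mdifferentiableAt (by simp))
        ((contMDiffAt_extChartAt_symm x hz).mdifferentiableAt (by simp))
    ext u v
    rw [pullbackForm_apply, hchain, lorentzForm_apply]
    exact (hf.isometric _ _ _).symm
  metric_pos u hu := by
    rw [chartMetric_self]
    exact g.pos x u hu

theorem exists_isComplexSubspace {K : KaehlerStructure n M} {f : M → HyperbolicSpace N}
    (hf : IsIsometricImmersion K.metric f) (hN : N + 2 ≤ 3 * n) (x : M) :
    ∃ (ℓ : ℕ) (V : Submodule ℝ (TangentSpace 𝓘(ℝ, Model n) x)),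
      3 * n + 1 ≤ ℓ + N ∧ K.IsComplexSubspace x V ℓ ∧
      ∀ S ∈ V, sectionalCurvature K.metric x S (K.J x S) ≤ 0 ∧ ricci K.metric x S ≤ 0 := by
  obtain ⟨V, hVJ, hdim, hV⟩ := (hf.isLocalImmersion x).exists_subspace (K.isLocalKaehler x)
    (Eventually.of_forall fun z ↦ (f _).2.1)
    (fun w ↦ lorentz_pos_of_orthogonal (f _).2.1)
    (by rw [finrank_lorentzSpace, finrank_euclideanSpace_fin]; omega)
  rw [chartEnd_self] at hVJ
  rw [chartEnd_self, chartMetric_self] at hV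
  rw [finrank_lorentzSpace, finrank_euclideanSpace_fin] at hdim
  let Jx : Model n →L[ℝ] Model n := K.J x
  obtain ⟨ℓ, hℓ⟩ := even_finrank_of_apply_apply_eq_neg
    (J := Jx.toLinearMap.restrict hVJ) fun X ↦ Subtype.ext (K.J_J x X.1)
  refine ⟨ℓ, V, by omega, ⟨hVJ, hℓ.trans (two_mul ℓ).symm⟩, fun S hS ↦ ⟨?_, ?_⟩⟩
  · rw [K.sectionalCurvature_J]
    exact div_nonpos_of_nonpos_of_nonneg (hV S hS).1 (sq_nonneg _)
  · exact (hV S hS).2 (curvatureOperator K.metric x S S) fun Z ↦ rfl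

end IsIsometricImmersion

end Chart

/-! ### Products of spheres and planes -/

namespace SphereProduct

section Metric

open scoped NNReal

variable {ι E : Type*} [NormedAddCommGroup E] [NormedSpace ℝ E]
  (c : E ≃L[ℝ] (ι → ℂ)) (κ : ι → ℝ≥0)

/-- The `i`-th complex coordinate in the complex coordinates `c`. -/
def coord (i : ι) : E →L[ℝ] ℂ :=
  ContinuousLinearMap.proj i ∘L c.toContinuousLinearMap

@[simp]
theorem coord_apply (i : ι) (u : E) : coord c i u = c u i := rfl

/-- The Euclidean inner product of the `i`-th complex coordinates. -/
def dot (i : ι) : E →L[ℝ] E →L[ℝ] ℝ :=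
  (innerSL ℝ).bilinearComp (coord c i) (coord c i)

@[simp]
theorem dot_apply (i : ι) (u v : E) : dot c i u v = inner ℝ (c u i) (c v i) := rfl

theorem dot_comm (i : ι) (u v : E) : dot c i u v = dot c i v u :=
  real_inner_comm (c v i) (c u i)

/-- The complex structure of the complex coordinates `c`. -/
def rot : E →L[ℝ] E :=
  c.symm.toContinuousLinearMap ∘L (Complex.I • ContinuousLinearMap.id ℝ (ι → ℂ)) ∘L
    c.toContinuousLinearMap

@[simp]
theorem apply_rot (u : E) (i : ι) : c (rot c u) i = Complex.I * c u i := by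
  simp [rot]

theorem rot_rot (u : E) : rot c (rot c u) = -u := by
  refine c.injective (funext fun i ↦ ?_)
  rw [apply_rot, apply_rot, ← mul_assoc, Complex.I_mul_I, map_neg, Pi.neg_apply, neg_one_mul]

theorem dot_self_nonneg (i : ι) (u : E) : 0 ≤ dot c i u u :=
  real_inner_self_nonneg (x := c u i)

theorem dot_rot_rot (i : ι) (u v : E) : dot c i (rot c u) (rot c v) = dot c i u v := by
  simp [Complex.inner]

/-- The conformal factor `1 + κ |z|² / 4` of the stereographic coordinate `z` of the sphere of
curvature `κ` (of the plane if `κ = 0`). -/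
def den (i : ι) (y : E) : ℝ := 1 + κ i / 4 * dot c i y y

theorem den_pos (i : ι) (y : E) : 0 < den c κ i y := by
  have := dot_self_nonneg c i y
  rw [den]
  positivity

@[simp]
theorem den_zero (i : ι) : den c κ i 0 = 1 := by simp [den]

theorem contDiff_den (i : ι) {k : ℕ∞ω} : ContDiff ℝ k (den c κ i) :=
  contDiff_const.add
    (contDiff_const.mul (((dot c i).contDiff.clm_apply contDiff_id)))

theorem hasFDerivAt_den (i : ι) (y : E) :
    HasFDerivAt (den c κ i) ((κ i / 2 : ℝ) • dot c i y) y := by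
  refine ((((dot c i).hasFDerivAt.clm_apply (hasFDerivAt_id y)).const_mul
    (κ i / 4 : ℝ)).const_add 1).congr_fderiv ?_
  ext u
  simp only [ContinuousLinearMap.comp_id, id_eq, smul_add, add_apply, smul_apply,
    ContinuousLinearMap.flip_apply, smul_eq_mul, dot_comm c i u y]
  ring

variable [Fintype ι]

/-- The product of the metrics of curvature `κ i`, in stereographic coordinates. -/
def metricForm (y : E) : E →L[ℝ] E →L[ℝ] ℝ := ∑ i, (den c κ i y ^ 2)⁻¹ • dot c i

theorem metricForm_apply (y u v : E) :
    metricForm c κ y u v = ∑ i, (den c κ i y ^ 2)⁻¹ * dot c i u v := by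
  simp [metricForm]

theorem metricForm_comm (y u v : E) : metricForm c κ y u v = metricForm c κ y v u := by
  simp only [metricForm_apply, dot_comm c _ u v]

theorem metricForm_rot (y u v : E) :
    metricForm c κ y (rot c u) (rot c v) = metricForm c κ y u v := by
  simp only [metricForm_apply, dot_rot_rot]

theorem mul_dot_le_metricForm (y u : E) (i : ι) :
    (den c κ i y ^ 2)⁻¹ * dot c i u u ≤ metricForm c κ y u u := by
  rw [metricForm_apply]
  exact Finset.single_le_sum (f := fun i ↦ (den c κ i y ^ 2)⁻¹ * dot c i u u)
    (fun j _ ↦ mul_nonneg (by positivity) (dot_self_nonneg c j u)) (Finset.mem_univ i)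

theorem metricForm_pos (y u : E) (hu : u ≠ 0) : 0 < metricForm c κ y u u := by
  obtain ⟨i, hi⟩ := Function.ne_iff.1 ((map_ne_zero_iff c c.injective).2 hu)
  refine lt_of_lt_of_le ?_ (mul_dot_le_metricForm c κ y u i)
  exact mul_pos (inv_pos.2 (pow_pos (den_pos c κ i y) 2)) (real_inner_self_pos.2 hi)

theorem isVonNBounded_metricForm (y : E) :
    Bornology.IsVonNBounded ℝ {u | metricForm c κ y u u < 1} := by
  have hbox : Bornology.IsBounded (Set.univ.pi fun i ↦ Metric.ball (0 : ℂ) (den c κ i y)) :=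
    .pi fun i ↦ Metric.isBounded_ball
  rw [NormedSpace.isVonNBounded_iff]
  refine (c.antilipschitz.isBounded_preimage hbox).subset fun u hu i _ ↦ ?_
  have hd := den_pos c κ i y
  have hlt : (den c κ i y ^ 2)⁻¹ * ‖c u i‖ ^ 2 < 1 := by
    rw [← real_inner_self_eq_norm_sq]
    exact (mul_dot_le_metricForm c κ y u i).trans_lt hu
  rw [inv_mul_lt_one₀ (pow_pos hd 2)] at hlt
  exact mem_ball_zero_iff.2 (lt_of_pow_lt_pow_left₀ 2 hd.le hlt)

theorem contDiff_metricForm {k : ℕ∞ω} : ContDiff ℝ k (metricForm c κ) :=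
  ContDiff.sum fun i _ ↦ (((contDiff_den c κ i).pow 2).inv
    fun y ↦ (pow_pos (den_pos c κ i y) 2).ne').smul contDiff_const

theorem isInvertible_metricForm (y : E) : (metricForm c κ y).IsInvertible := by
  have := c.symm.toLinearEquiv.finiteDimensional
  exact isInvertible_of_pos (metricForm_pos c κ y)

theorem fderiv_metricForm_apply (y u v w : E) :
    fderiv ℝ (metricForm c κ) y u v w =
      ∑ i, -(κ i * dot c i y u) / den c κ i y ^ 3 * dot c i v w := by
  have hderiv : HasFDerivAt (metricForm c κ) _ y := HasFDerivAt.fun_sum fun i _ ↦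
    ((hasDerivAt_inv (pow_pos (den_pos c κ i y) 2).ne').comp_hasFDerivAt y
      ((hasFDerivAt_den c κ i y).pow 2)).smul_const (dot c i)
  rw [hderiv.fderiv]
  simp only [sum_apply]
  refine Finset.sum_congr rfl fun i _ ↦ ?_
  have hd := (den_pos c κ i y).ne'
  simp only [Nat.add_one_sub_one, pow_one, nsmul_eq_mul, Nat.cast_ofNat, neg_smul,
    ContinuousLinearMap.smulRight_apply, neg_apply, smul_apply, smul_eq_mul]
  field_simp

theorem koszul_metricForm (y u v w : E) :
    koszul (metricForm c κ) y u v w = ∑ i, -(κ i / (2 * den c κ i y ^ 3)) *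
      (dot c i y u * dot c i v w + dot c i y v * dot c i u w - dot c i y w * dot c i u v) := by
  rw [koszul_apply]
  simp only [fderiv_metricForm_apply, ← Finset.sum_add_distrib, ← Finset.sum_sub_distrib,
    Finset.mul_sum]
  refine Finset.sum_congr rfl fun i _ ↦ ?_
  ring

-- In the plane, `⟨y, v⟩ ⟨u, w⟩ - ⟨y, w⟩ ⟨u, v⟩ = ω(y, u) ω(v, w)` with `ω` the area form, for which
-- the complex structure is skew.
theorem koszul_metricForm_rot (y u v w : E) :
    koszul (metricForm c κ) y u (rot c v) w = -koszul (metricForm c κ) y u v (rot c w) := by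
  rw [koszul_metricForm, koszul_metricForm, ← Finset.sum_neg_distrib]
  refine Finset.sum_congr rfl fun i _ ↦ ?_
  simp only [dot_apply, apply_rot, Complex.inner, Complex.mul_re, Complex.mul_im, Complex.conj_re,
    Complex.conj_im, map_mul, Complex.conj_I, Complex.neg_re, Complex.neg_im, Complex.I_re,
    Complex.I_im]
  ring

theorem localCovDerivEnd_rot (y u v : E) :
    localCovDerivEnd (metricForm c κ) (fun _ ↦ rot c) y u v = 0 := by
  have hinv := isInvertible_metricForm c κ y
  have hskew (a b : E) : metricForm c κ y (rot c a) b = -metricForm c κ y a (rot c b) := by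
    rw [← metricForm_rot, rot_rot, map_neg, neg_apply]
  refine hinv.injective (ContinuousLinearMap.ext fun w ↦ ?_)
  rw [localCovDerivEnd, map_zero, map_sub, map_add, sub_apply, add_apply, hskew,
    apply_christoffel hinv, apply_christoffel hinv, koszul_metricForm_rot]
  simp

theorem christoffel_metricForm_zero : christoffel (metricForm c κ) 0 = 0 := by
  have hinv := isInvertible_metricForm c κ 0
  ext u v
  refine hinv.injective (ContinuousLinearMap.ext fun w ↦ ?_)
  rw [apply_christoffel hinv, koszul_metricForm]
  simp

theorem fderiv_koszul_metricForm_zero (u v w t : E) :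
    fderiv ℝ (fun y ↦ koszul (metricForm c κ) y v w t) 0 u = ∑ i, -(κ i / 2 : ℝ) *
      (dot c i u v * dot c i w t + dot c i u w * dot c i v t - dot c i u t * dot c i v w) := by
  let L (i : ι) : E →L[ℝ] ℝ := dot c i w t • (dot c i).flip v + dot c i v t • (dot c i).flip w -
    dot c i v w • (dot c i).flip t
  have hderiv (i : ι) : HasFDerivAt (fun y ↦ -(κ i / (2 * den c κ i y ^ 3)) * L i y)
      (-(κ i / 2 : ℝ) • L i) 0 := by
    have hden := (hasFDerivAt_den c κ i 0).differentiableAt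
    have hfactor : DifferentiableAt ℝ (fun y ↦ -(κ i / (2 * den c κ i y ^ 3) : ℝ)) 0 := by
      fun_prop (disch := simp)
    exact (hfactor.hasFDerivAt.mul (L i).hasFDerivAt).congr_fderiv (by simp)
  have hL (y : E) : koszul (metricForm c κ) y v w t =
      ∑ i, -(κ i / (2 * den c κ i y ^ 3)) * L i y := by
    rw [koszul_metricForm]
    refine Finset.sum_congr rfl fun i _ ↦ ?_
    simp only [L, sub_apply, add_apply, smul_apply, ContinuousLinearMap.flip_apply, smul_eq_mul]
    ring
  simp only [hL, (HasFDerivAt.fun_sum fun i _ ↦ hderiv i).fderiv, sum_apply]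
  refine Finset.sum_congr rfl fun i _ ↦ ?_
  simp only [L, sub_apply, add_apply, smul_apply, ContinuousLinearMap.flip_apply, smul_eq_mul]
  ring

theorem metricForm_localCurvature_zero (u v w t : E) :
    metricForm c κ 0 (localCurvature (metricForm c κ) 0 u v w) t =
      ∑ i, κ i * (dot c i v w * dot c i u t - dot c i u w * dot c i v t) := by
  have := c.symm.toLinearEquiv.finiteDimensional
  have := FiniteDimensional.complete ℝ E
  have hG := (contDiff_metricForm (k := 2) c κ).contDiffAt (x := 0)
  have hinv := isInvertible_metricForm c κ 0
  rw [localCurvature, christoffel_metricForm_zero]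
  simp only [zero_apply, add_zero, sub_zero, map_sub, sub_apply,
    apply_fderiv_christoffel hG hinv, christoffel_metricForm_zero, map_zero,
    fderiv_koszul_metricForm_zero]
  rw [← Finset.sum_sub_distrib]
  refine Finset.sum_congr rfl fun i _ ↦ ?_
  simp only [dot_apply, real_inner_comm]
  ring

theorem metricForm_localCurvature_rot_zero (S : E) :
    metricForm c κ 0 (localCurvature (metricForm c κ) 0 S (rot c S) (rot c S)) S =
      ∑ i, κ i * dot c i S S ^ 2 := by
  rw [metricForm_localCurvature_zero]
  refine Finset.sum_congr rfl fun i _ ↦ ?_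
  have hrot : dot c i S (rot c S) = 0 := by
    simp only [dot_apply, apply_rot, Complex.inner, Complex.mul_re, Complex.mul_im,
      Complex.conj_re, Complex.conj_im, Complex.I_re, Complex.I_im]
    ring
  rw [dot_rot_rot, hrot]
  ring

open Classical in
/-- The real basis attached to complex coordinates: `1` and `I` in each of them. -/
def coordBasis : Module.Basis ((_ : ι) × Fin 2) ℝ E :=
  (Pi.basis fun _ : ι ↦ Complex.orthonormalBasisOneI.toBasis).map c.symm.toLinearEquiv

open Classical in
theorem apply_coordBasis (i j : ι) (k : Fin 2) :
    c (coordBasis c ⟨j, k⟩) i = if i = j then Complex.orthonormalBasisOneI k else 0 := by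
  simp [coordBasis, Pi.basis_apply, Pi.single_apply]

open Classical in
theorem dot_coordBasis (i j : ι) (k : Fin 2) (u : E) :
    dot c i (coordBasis c ⟨j, k⟩) u =
      if i = j then inner ℝ (Complex.orthonormalBasisOneI k) (c u i) else 0 := by
  rw [dot_apply, apply_coordBasis, apply_ite (fun z ↦ inner ℝ z (c u i)), inner_zero_left]

open Classical in
theorem isOrthonormalBasis_coordBasis :
    IsOrthonormalBasis (metricForm c κ (0 : E)).toLinearMap₁₂ (coordBasis c) := by
  rintro ⟨i, k⟩ ⟨j, l⟩
  change metricForm c κ 0 (coordBasis c ⟨i, k⟩) (coordBasis c ⟨j, l⟩) = _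
  simp only [metricForm_apply, dot_coordBasis, den_zero, one_pow, inv_one, one_mul,
    Finset.sum_ite_eq', Finset.mem_univ, if_true, apply_coordBasis]
  by_cases hij : i = j
  · simp [hij, -Complex.coe_orthonormalBasisOneI, OrthonormalBasis.inner_eq_ite]
  · simp [hij]

theorem trace_localCurvature_zero {S : E} {A : E →ₗ[ℝ] E}
    (hA : ∀ X, A X = localCurvature (metricForm c κ) 0 X S S) :
    LinearMap.trace ℝ E A = ∑ i, κ i * dot c i S S := by
  classical
  rw [(isOrthonormalBasis_coordBasis c κ).trace_eq_sum, Fintype.sum_sigma]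
  refine Finset.sum_congr rfl fun i _ ↦ ?_
  change ∑ k, metricForm c κ 0 (A (coordBasis c ⟨i, k⟩)) (coordBasis c ⟨i, k⟩) = _
  have hterm (k : Fin 2) :
      metricForm c κ 0 (A (coordBasis c ⟨i, k⟩)) (coordBasis c ⟨i, k⟩) =
        κ i * (dot c i S S - inner ℝ (Complex.orthonormalBasisOneI k) (c S i) ^ 2) := by
    rw [hA, metricForm_localCurvature_zero, Finset.sum_eq_single i]
    · rw [dot_coordBasis, dot_coordBasis, dot_apply c i S (coordBasis c ⟨i, k⟩),
        apply_coordBasis, if_pos rfl, if_pos rfl, if_pos rfl,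
        real_inner_comm _ (c S i), OrthonormalBasis.inner_eq_one]
      ring
    · intro j _ hj
      simp [dot_coordBasis, hj, -dot_apply]
    · simp
  rw [Finset.sum_congr rfl fun k _ ↦ hterm k, ← Finset.mul_sum, Finset.sum_sub_distrib,
    OrthonormalBasis.sum_sq_inner_right, Finset.sum_const, Finset.card_univ, Fintype.card_fin,
    dot_apply, real_inner_self_eq_norm_sq]
  ring

theorem apply_eq_zero_of_sum_mul_nonpos {φ : ι → ℝ} (hφ : ∀ i, 0 ≤ φ i)
    (hsum : ∑ i, κ i * φ i ≤ 0) {i : ι} (hi : κ i ≠ 0) : φ i = 0 := by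
  have hterm : ∀ i ∈ Finset.univ, 0 ≤ κ i * φ i := fun i _ ↦ mul_nonneg (κ i).2 (hφ i)
  have hzero := (Finset.sum_eq_zero_iff_of_nonneg hterm).1
    (hsum.antisymm (Finset.sum_nonneg hterm)) i (Finset.mem_univ i)
  exact (mul_eq_zero.1 hzero).resolve_left (NNReal.coe_ne_zero.2 hi)

theorem finrank_le_of_apply_eq_zero (V : Submodule ℝ E)
    (hV : ∀ S ∈ V, ∀ i, κ i ≠ 0 → c S i = 0) :
    Module.finrank ℝ V ≤ 2 * Fintype.card {i // κ i = 0} := by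
  let flat : V →ₗ[ℝ] {i // κ i = 0} → ℂ :=
    LinearMap.funLeft ℝ ℂ Subtype.val ∘ₗ c.toLinearEquiv.toLinearMap ∘ₗ V.subtype
  have hflat : Function.Injective flat := by
    refine (injective_iff_map_eq_zero flat).2 fun S hS ↦ Subtype.ext (c.injective ?_)
    ext i
    by_cases hi : κ i = 0
    · simpa [flat] using congrFun hS ⟨i, hi⟩
    · simpa using hV S S.2 i hi
  have hle := LinearMap.finrank_le_finrank_of_injective hflat
  rw [Module.finrank_pi_fintype] at hle
  simpa [Complex.finrank_real_complex, mul_comm] using hle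

end Metric

end SphereProduct

/-! ### Immersions in the hyperbolic space -/

section Horosphere

variable {E : Type*} [NormedAddCommGroup E] [InnerProductSpace ℝ E] {N : ℕ}
  (A : WithLp 2 (E × ℝ) →ₗᵢ[ℝ] EuclideanSpace ℝ (Fin N))

/-- The isometric embedding of a Euclidean space as a horosphere: up to the linear isometry `A`,
the paraboloid over the Euclidean space in the light-like direction `(1, (0, 1))`. -/
def horosphere (X : E) : LorentzSpace N :=
  (1 + ‖X‖ ^ 2 / 2, A (WithLp.toLp 2 (X, ‖X‖ ^ 2 / 2)))

theorem lorentz_horosphere (X : E) : lorentz (horosphere A X) (horosphere A X) = -1 := by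
  rw [lorentz, horosphere, A.inner_map_map, WithLp.prod_inner_apply, real_inner_self_eq_norm_sq,
    real_inner_self_eq_norm_sq, Real.norm_eq_abs, sq_abs]
  ring

theorem horosphere_fst_pos (X : E) : 0 < (horosphere A X).1 := by
  rw [horosphere]
  positivity

theorem contDiff_horosphere {k : ℕ∞ω} : ContDiff ℝ k (horosphere A) := by
  have hsq : ContDiff ℝ k fun X : E ↦ ‖X‖ ^ 2 / 2 := (contDiff_norm_sq ℝ).div_const 2
  exact (contDiff_const.add hsq).prodMk (A.contDiff.comp
    ((WithLp.prodContinuousLinearEquiv 2 ℝ E ℝ).symm.contDiff.comp (contDiff_id.prodMk hsq)))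

theorem fderiv_horosphere_apply (X u : E) :
    fderiv ℝ (horosphere A) X u = (inner ℝ X u, A (WithLp.toLp 2 (u, inner ℝ X u))) := by
  have hsq : HasFDerivAt (fun X : E ↦ ‖X‖ ^ 2 / 2) (innerSL ℝ X) X := by
    refine (((hasStrictFDerivAt_norm_sq X).hasFDerivAt.mul_const (2⁻¹ : ℝ)).congr_fderiv ?_)
    ext u
    simp
  have hderiv : HasFDerivAt (horosphere A) _ X :=
    (hsq.const_add 1).prodMk (A.toContinuousLinearMap.hasFDerivAt.comp X
      ((WithLp.prodContinuousLinearEquiv 2 ℝ E ℝ).symm.hasFDerivAt.comp X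
        ((hasFDerivAt_id X).prodMk hsq)))
  rw [hderiv.fderiv]
  rfl

theorem lorentz_fderiv_horosphere (X u v : E) :
    lorentz (fderiv ℝ (horosphere A) X u) (fderiv ℝ (horosphere A) X v) = inner ℝ u v := by
  rw [fderiv_horosphere_apply, fderiv_horosphere_apply, lorentz, A.inner_map_map,
    WithLp.prod_inner_apply]
  simp only [RCLike.inner_apply, conj_trivial]
  ring

theorem exists_linearIsometry_prod_real [FiniteDimensional ℝ E]
    (hN : Module.finrank ℝ E + 1 = N) :
    Nonempty (WithLp 2 (E × ℝ) →ₗᵢ[ℝ] EuclideanSpace ℝ (Fin N)) := by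
  have hdim : Module.finrank ℝ (WithLp 2 (E × ℝ)) = N := by
    rw [(WithLp.linearEquiv 2 ℝ (E × ℝ)).finrank_eq, Module.finrank_prod, Module.finrank_self, hN]
  exact ⟨((stdOrthonormalBasis ℝ (WithLp 2 (E × ℝ))).reindex
    (finCongr hdim)).repr.toLinearIsometry⟩

end Horosphere

namespace SphereProduct

section Immersion

open scoped NNReal

variable {ι E : Type*} [NormedAddCommGroup E] [NormedSpace ℝ E]
  (c : E ≃L[ℝ] (ι → ℂ)) (κ : ι → ℝ≥0)

/-- The `i`-th spherical factor in stereographic coordinates: the horizontal component. -/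
def stereo (i : ι) (y : E) : ℂ := (den c κ i y)⁻¹ • c y i

/-- The `i`-th spherical factor in stereographic coordinates: the height above the pole. -/
def height (i : ι) (y : E) : ℝ := √(κ i) / 2 * ((den c κ i y)⁻¹ * dot c i y y)

theorem contDiff_stereo (i : ι) {k : ℕ∞ω} : ContDiff ℝ k (stereo c κ i) :=
  ((contDiff_den c κ i).inv fun y ↦ (den_pos c κ i y).ne').smul (coord c i).contDiff

theorem contDiff_height (i : ι) {k : ℕ∞ω} : ContDiff ℝ k (height c κ i) :=
  contDiff_const.mul (((contDiff_den c κ i).inv fun y ↦ (den_pos c κ i y).ne').mul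
    ((dot c i).contDiff.clm_apply contDiff_id))

theorem fderiv_stereo_apply (i : ι) (y u : E) :
    fderiv ℝ (stereo c κ i) y u = (den c κ i y)⁻¹ • c u i -
      (κ i / (2 * den c κ i y ^ 2) * dot c i y u) • c y i := by
  have hd := (den_pos c κ i y).ne'
  have hderiv : HasFDerivAt (stereo c κ i) _ y :=
    ((hasDerivAt_inv hd).comp_hasFDerivAt y (hasFDerivAt_den c κ i y)).smul
      (coord c i).hasFDerivAt
  rw [hderiv.fderiv]
  simp only [Function.comp_apply, add_apply, smul_apply, ContinuousLinearMap.smulRight_apply,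
    coord_apply, smul_eq_mul, sub_eq_add_neg, ← neg_smul]
  congr 2
  field_simp

theorem fderiv_height_apply (i : ι) (y u : E) :
    fderiv ℝ (height c κ i) y u = √(κ i) / den c κ i y ^ 2 * dot c i y u := by
  have hd := (den_pos c κ i y).ne'
  have hderiv : HasFDerivAt (height c κ i) _ y :=
    (((hasDerivAt_inv hd).comp_hasFDerivAt y (hasFDerivAt_den c κ i y)).mul
      ((dot c i).hasFDerivAt.clm_apply (hasFDerivAt_id y))).const_mul (√(κ i) / 2)
  rw [hderiv.fderiv]
  simp only [Function.comp_apply, add_apply, smul_apply, smul_eq_mul,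
    ContinuousLinearMap.comp_apply, ContinuousLinearMap.flip_apply, id_eq, dot_comm c i u y,
    ContinuousLinearMap.id_apply]
  field_simp
  rw [den]
  ring

theorem inner_fderiv_stereo_add (i : ι) (y u v : E) :
    inner ℝ (fderiv ℝ (stereo c κ i) y u) (fderiv ℝ (stereo c κ i) y v) +
      inner ℝ (fderiv ℝ (height c κ i) y u) (fderiv ℝ (height c κ i) y v) =
      (den c κ i y ^ 2)⁻¹ * dot c i u v := by
  have hd := (den_pos c κ i y).ne'
  have hden : κ i * dot c i y y = 4 * (den c κ i y - 1) := by rw [den]; ring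
  simp only [fderiv_stereo_apply, fderiv_height_apply, inner_sub_left, inner_sub_right,
    real_inner_smul_left, real_inner_smul_right, RCLike.inner_apply, conj_trivial,
    ← dot_apply, dot_comm c i u y]
  generalize den c κ i y = d at *
  field_simp
  rw [Real.sq_sqrt (κ i).coe_nonneg]
  linear_combination (κ i * dot c i y u * dot c i y v) * hden

/-- The Euclidean space with two horizontal coordinates for each factor and a height coordinate for
each spherical factor. -/
abbrev Ambient (κ : ι → ℝ≥0) : Type _ :=
  WithLp 2 (EuclideanSpace ℂ ι × EuclideanSpace ℝ {i // κ i ≠ 0})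

theorem finrank_ambient [Fintype ι] :
    Module.finrank ℝ (Ambient κ) = 2 * Fintype.card ι + Fintype.card {i // κ i ≠ 0} := by
  rw [(WithLp.linearEquiv 2 ℝ (EuclideanSpace ℂ ι × EuclideanSpace ℝ {i // κ i ≠ 0})).finrank_eq,
    Module.finrank_prod, finrank_euclideanSpace,
    (WithLp.linearEquiv 2 ℝ (ι → ℂ)).finrank_eq, Module.finrank_pi_fintype]
  simp [Complex.finrank_real_complex, mul_comm]

/-- The isometric embedding of the product of spheres and planes in a Euclidean space. -/
def embedding (y : E) : Ambient κ :=
  WithLp.toLp 2 (WithLp.toLp 2 fun i ↦ stereo c κ i y, WithLp.toLp 2 fun i ↦ height c κ i y)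

theorem contDiff_embedding [Fintype ι] {k : ℕ∞ω} : ContDiff ℝ k (embedding c κ) :=
  (WithLp.prodContinuousLinearEquiv 2 ℝ (EuclideanSpace ℂ ι)
    (EuclideanSpace ℝ {i // κ i ≠ 0})).symm.contDiff.comp
    ((contDiff_piLp' 2 fun i ↦ contDiff_stereo c κ i).prodMk
      (contDiff_piLp' 2 fun i ↦ contDiff_height c κ i))

theorem fderiv_embedding_fst_apply [Finite ι] (y u : E) (i : ι) :
    (fderiv ℝ (embedding c κ) y u).fst i = fderiv ℝ (stereo c κ i) y u := by
  have := Fintype.ofFinite ι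
  have hd := (contDiff_embedding (k := 1) c κ).differentiable one_ne_zero y
  have hcomp := ((PiLp.proj (𝕜 := ℝ) 2 (fun _ ↦ ℂ) i ∘L WithLp.fstL 2 ℝ _ _).hasFDerivAt.comp y
    hd.hasFDerivAt).fderiv
  exact (DFunLike.congr_fun hcomp u).symm

theorem fderiv_embedding_snd_apply [Finite ι] (y u : E) (i : {i // κ i ≠ 0}) :
    (fderiv ℝ (embedding c κ) y u).snd i = fderiv ℝ (height c κ i) y u := by
  have := Fintype.ofFinite ι
  have hd := (contDiff_embedding (k := 1) c κ).differentiable one_ne_zero y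
  have hcomp := ((EuclideanSpace.proj (𝕜 := ℝ) i ∘L WithLp.sndL 2 ℝ _ _).hasFDerivAt.comp y
    hd.hasFDerivAt).fderiv
  exact (DFunLike.congr_fun hcomp u).symm

theorem inner_fderiv_embedding [Fintype ι] (y u v : E) :
    inner ℝ (fderiv ℝ (embedding c κ) y u) (fderiv ℝ (embedding c κ) y v) =
      metricForm c κ y u v := by
  have hheight : ∑ i : {i // κ i ≠ 0}, inner ℝ (fderiv ℝ (height c κ i) y u)
      (fderiv ℝ (height c κ i) y v) =
      ∑ i, inner ℝ (fderiv ℝ (height c κ i) y u) (fderiv ℝ (height c κ i) y v) := by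
    rw [← Finset.sum_subtype (Finset.univ.filter fun i ↦ κ i ≠ 0) (by simp) fun i ↦
      inner ℝ (fderiv ℝ (height c κ i) y u) (fderiv ℝ (height c κ i) y v)]
    refine Finset.sum_filter_of_ne fun i _ hi hκ ↦ hi ?_
    simp [fderiv_height_apply, hκ]
  have hinner : inner ℝ (fderiv ℝ (embedding c κ) y u) (fderiv ℝ (embedding c κ) y v) =
      ∑ i, inner ℝ ((fderiv ℝ (embedding c κ) y u).fst i) ((fderiv ℝ (embedding c κ) y v).fst i) +
      ∑ i, inner ℝ ((fderiv ℝ (embedding c κ) y u).snd i)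
        ((fderiv ℝ (embedding c κ) y v).snd i) := rfl
  simp only [hinner, fderiv_embedding_fst_apply, fderiv_embedding_snd_apply, hheight,
    ← Finset.sum_add_distrib, inner_fderiv_stereo_add, metricForm_apply]

theorem lorentz_fderiv_horosphere_embedding [Fintype ι] {N : ℕ}
    (A : WithLp 2 (Ambient κ × ℝ) →ₗᵢ[ℝ] EuclideanSpace ℝ (Fin N)) (y u v : E) :
    lorentz (fderiv ℝ (horosphere A ∘ embedding c κ) y u)
      (fderiv ℝ (horosphere A ∘ embedding c κ) y v) = metricForm c κ y u v := by
  rw [fderiv_comp y ((contDiff_horosphere (k := 1) A).differentiable one_ne_zero _)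
    ((contDiff_embedding (k := 1) c κ).differentiable one_ne_zero y)]
  exact (lorentz_fderiv_horosphere A _ _ _).trans (inner_fderiv_embedding c κ y u v)

end Immersion

end SphereProduct

/-! ### The sharp examples -/

section ModelSections

variable {F : Type*} [NormedAddCommGroup F] [NormedSpace ℝ F]

theorem contMDiff_end_section {T : F → F →L[ℝ] F} (hT : ContDiff ℝ ∞ T) :
    ContMDiff 𝓘(ℝ, F) (𝓘(ℝ, F).prod 𝓘(ℝ, F →L[ℝ] F)) ∞
    (fun x : F ↦ Bundle.TotalSpace.mk' (F →L[ℝ] F)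
      (E := fun x : F ↦ TangentSpace 𝓘(ℝ, F) x →L[ℝ] TangentSpace 𝓘(ℝ, F) x) x (T x)) := by
  intro x
  refine (contMDiffAt_hom_bundle _).2 ⟨contMDiffAt_id, ?_⟩
  refine hT.contMDiff.contMDiffAt.congr_of_eventuallyEq (Eventually.of_forall fun y ↦ ?_)
  exact inCoordinates_tangent_bundle_core_model_space (I := 𝓘(ℝ, F)) (I' := 𝓘(ℝ, F)) x y x y (T y)

theorem trivializationAt_form_apply
    (B : ∀ x : F, TangentSpace 𝓘(ℝ, F) x →L[ℝ] TangentSpace 𝓘(ℝ, F) x →L[ℝ] ℝ) (x y v w : F) :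
    (trivializationAt (F →L[ℝ] F →L[ℝ] ℝ) (fun x : F ↦ TangentSpace 𝓘(ℝ, F) x
      →L[ℝ] TangentSpace 𝓘(ℝ, F) x →L[ℝ] ℝ) x ⟨y, B y⟩).2 v w = B y v w := by
  have hsymmL : (trivializationAt F (TangentSpace 𝓘(ℝ, F)) x).symmL ℝ y =
      ContinuousLinearMap.id ℝ F := TangentBundle.symmL_model_space ..
  have hbase : y ∈ (trivializationAt (F →L[ℝ] ℝ)
      (fun x : F ↦ TangentSpace 𝓘(ℝ, F) x →L[ℝ] ℝ) x).baseSet := by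
    simp only [hom_trivializationAt_baseSet, TangentBundle.trivializationAt_baseSet]
    exact ⟨Set.mem_univ y, Set.mem_univ y⟩
  simp only [hom_trivializationAt_apply, ContinuousLinearMap.inCoordinates]
  rw [ContinuousLinearMap.comp_apply, ContinuousLinearMap.comp_apply, hsymmL]
  simp only [Bundle.Trivialization.continuousLinearMapAt_apply,
    Bundle.Trivialization.linearMapAt_apply, hom_trivializationAt_apply,
    ContinuousLinearMap.inCoordinates, hsymmL, if_pos hbase]
  simp only [Bundle.Trivial.fiberBundle_trivializationAt',
    Bundle.Trivial.continuousLinearMapAt_trivialization, ContinuousLinearMap.id_comp]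
  rfl

theorem contMDiff_form_section {T : F → F →L[ℝ] F →L[ℝ] ℝ} (hT : ContDiff ℝ ∞ T) :
    ContMDiff 𝓘(ℝ, F) (𝓘(ℝ, F).prod 𝓘(ℝ, F →L[ℝ] F →L[ℝ] ℝ)) ∞
    (fun x : F ↦ Bundle.TotalSpace.mk' (F →L[ℝ] F →L[ℝ] ℝ)
      (E := fun x : F ↦ TangentSpace 𝓘(ℝ, F) x →L[ℝ] TangentSpace 𝓘(ℝ, F) x →L[ℝ] ℝ)
        x (T x)) := by
  intro x
  refine (Bundle.contMDiffAt_section x).2 ?_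
  refine hT.contMDiff.contMDiffAt.congr_of_eventuallyEq (Eventually.of_forall fun y ↦ ?_)
  ext v w
  exact trivializationAt_form_apply T x y v w

end ModelSections

namespace SphereProduct

open scoped NNReal

attribute [local instance] chartedSpaceSelf

section Chart

variable {n : ℕ}

theorem chartSymmDeriv_model (x y u : Model n) : (chartSymmDeriv x y u : Model n) = u := by
  have hid : chartSymmDeriv x y = ContinuousLinearMap.id ℝ (Model n) := mfderiv_id
  exact congrArg (fun T : Model n →L[ℝ] Model n ↦ T u) hid

theorem chartDeriv_model (x y u : Model n) :
    (chartDeriv x y : Model n →L[ℝ] Model n) u = u := by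
  have hid : chartDeriv x y = ContinuousLinearMap.id ℝ (Model n) := mfderiv_id
  exact congrArg (fun T : Model n →L[ℝ] Model n ↦ T u) hid

theorem chartEnd_model (J : Model n → Model n →L[ℝ] Model n) (x : Model n) :
    chartEnd (n := n) J x = J := by
  ext1 y
  ext1 u
  exact (chartDeriv_model x y _).trans (congrArg (J y) (chartSymmDeriv_model x y u))

end Chart

variable {n : ℕ} {ι : Type*} [Fintype ι] (c : Model n ≃L[ℝ] (ι → ℂ)) (κ : ι → ℝ≥0)

/-- The product metric of the spheres and planes, in stereographic coordinates, as a Riemannian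
metric on the model space. -/
def metric : RiemannianMetric n (Model n) where
  inner y := metricForm c κ y
  symm y u v := metricForm_comm c κ y u v
  pos y u hu := metricForm_pos c κ y u hu
  isVonNBounded y := isVonNBounded_metricForm c κ y
  contMDiff := contMDiff_form_section (contDiff_metricForm c κ)

theorem chartMetric_metric (x : Model n) : chartMetric (metric c κ) x = metricForm c κ := by
  ext y u v
  exact congrArg₂ (fun a b : Model n ↦ metricForm c κ y a b) (chartSymmDeriv_model x y u)
    (chartSymmDeriv_model x y v)

/-- The Kaehler structure of the product of spheres and planes. -/
def kaehlerStructure : KaehlerStructure n (Model n) where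
  metric := metric c κ
  J _ := rot c
  contMDiff_J := contMDiff_end_section contDiff_const
  J_J _ u := rot_rot c u
  inner_J_J y u v := metricForm_rot c κ y u v
  parallel_J x₀ y _ u v := by
    rw [chartMetric_metric, chartEnd_model]
    exact localCovDerivEnd_rot c κ y u v

/-- The isometric immersion of the product of spheres and planes through a horosphere. -/
def hyperbolicImmersion {N : ℕ} (A : WithLp 2 (Ambient κ × ℝ) →ₗᵢ[ℝ] EuclideanSpace ℝ (Fin N))
    (y : Model n) : HyperbolicSpace N :=
  ⟨horosphere A (embedding c κ y), lorentz_horosphere A _, horosphere_fst_pos A _⟩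

theorem isIsometricImmersion {N : ℕ}
    (A : WithLp 2 (Ambient κ × ℝ) →ₗᵢ[ℝ] EuclideanSpace ℝ (Fin N)) :
    IsIsometricImmersion (metric c κ) (hyperbolicImmersion c κ A) where
  contMDiff := ((contDiff_horosphere A).comp (contDiff_embedding c κ)).contMDiff
  isometric x u v := by
    rw [mfderiv_eq_fderiv]
    exact lorentz_fderiv_horosphere_embedding c κ A x u v

theorem curvature_metric_zero (u v w : Model n) :
    curvature (metric c κ) (0 : Model n) u v w = localCurvature (metricForm c κ) 0 u v w := by
  change localCurvature (chartMetric (metric c κ) 0) (0 : Model n) u v w = _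
  rw [chartMetric_metric]

theorem sectionalCurvature_zero (S : Model n) :
    sectionalCurvature (kaehlerStructure c κ).metric (0 : Model n) S
      ((kaehlerStructure c κ).J 0 S) =
      (∑ i, κ i * dot c i S S ^ 2) / metricForm c κ 0 S S ^ 2 := by
  have hcurv : (metricForm c κ 0) (curvature (metric c κ) (0 : Model n) S (rot c S) (rot c S)) S =
      ∑ i, κ i * dot c i S S ^ 2 := by
    rw [← metricForm_localCurvature_rot_zero, ← curvature_metric_zero]
  exact ((kaehlerStructure c κ).sectionalCurvature_J (0 : Model n) S).trans
    (congrArg (· / metricForm c κ 0 S S ^ 2) hcurv)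

theorem ricci_zero (S : Model n) :
    ricci (metric c κ) (0 : Model n) S = ∑ i, κ i * dot c i S S :=
  trace_localCurvature_zero c κ (A := curvatureOperator (metric c κ) (0 : Model n) S S)
    fun X ↦ curvature_metric_zero c κ X S S

variable {c κ}

theorem apply_eq_zero_of_sectionalCurvature_nonpos {S : Model n}
    (hS : S ≠ 0 → sectionalCurvature (kaehlerStructure c κ).metric (0 : Model n) S
      ((kaehlerStructure c κ).J 0 S) ≤ 0) {i : ι} (hi : κ i ≠ 0) : c S i = 0 := by
  rcases eq_or_ne S 0 with rfl | hS0
  · simp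
  have hnonpos := hS hS0
  rw [sectionalCurvature_zero, div_le_iff₀ (pow_pos (metricForm_pos c κ 0 S hS0) 2),
    zero_mul] at hnonpos
  have hdot := apply_eq_zero_of_sum_mul_nonpos κ (fun i ↦ sq_nonneg (dot c i S S)) hnonpos hi
  exact inner_self_eq_zero.1 (pow_eq_zero_iff two_ne_zero |>.1 hdot)

theorem apply_eq_zero_of_ricci_nonpos {S : Model n}
    (hS : ricci (kaehlerStructure c κ).metric (0 : Model n) S ≤ 0) {i : ι} (hi : κ i ≠ 0) :
    c S i = 0 :=
  inner_self_eq_zero.1 (apply_eq_zero_of_sum_mul_nonpos κ (fun i ↦ dot_self_nonneg c i S)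
    ((ricci_zero c κ S).symm.trans_le hS) hi)

theorem le_card_of_isComplexSubspace {ℓ : ℕ}
    {V : Submodule ℝ (TangentSpace 𝓘(ℝ, Model n) (0 : Model n))}
    (hV : (kaehlerStructure c κ).IsComplexSubspace 0 V ℓ)
    (hzero : ∀ S : Model n, S ∈ V → ∀ i, κ i ≠ 0 → c S i = 0) :
    ℓ ≤ Fintype.card {i // κ i = 0} :=
  Nat.le_of_mul_le_mul_left (hV.2.symm.trans_le (finrank_le_of_apply_eq_zero c κ V hzero)) two_pos

theorem exists_curvature_card {n m : ℕ} (hm : m ≤ n) : ∃ κ : Fin n → ℝ≥0,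
    Fintype.card {i // κ i ≠ 0} = m ∧ Fintype.card {i // κ i = 0} = n - m := by
  obtain ⟨s, -, hs⟩ := Finset.exists_subset_card_eq (s := (Finset.univ : Finset (Fin n)))
    (by simpa using hm)
  have hne : Fintype.card {i // (s : Set (Fin n)).indicator (1 : Fin n → ℝ≥0) i ≠ 0} = m := by
    rw [Fintype.card_subtype, ← hs]
    congr 1
    ext i
    simp
  refine ⟨(s : Set (Fin n)).indicator 1, hne, ?_⟩
  have hcompl := Fintype.card_subtype_compl
    fun i ↦ (s : Set (Fin n)).indicator (1 : Fin n → ℝ≥0) i ≠ 0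
  simpa only [not_not, Fintype.card_fin, hne] using hcompl

end SphereProduct

end KaehlerHyperbolic

end

open KaehlerHyperbolic in
theorem theorem2 (n p : ℕ) (hp : 1 ≤ p) (hpn : p + 2 ≤ n) :
    -- the estimate
    (∀ (M : Type*) [TopologicalSpace M] [ChartedSpace (Model n) M]
      [IsManifold 𝓘(ℝ, Model n) ∞ M] (K : KaehlerStructure n M)
      (f : M → HyperbolicSpace (2 * n + p)), IsIsometricImmersion K.metric f →
      ∀ x : M, ∃ (ℓ : ℕ) (V : Submodule ℝ (TangentSpace 𝓘(ℝ, Model n) x)),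
        n - p + 1 ≤ ℓ ∧ K.IsComplexSubspace x V ℓ ∧
        ∀ S ∈ V, (S ≠ 0 → sectionalCurvature K.metric x S (K.J x S) ≤ 0) ∧
          ricci K.metric x S ≤ 0) ∧
    -- its sharpness, for each of the two curvatures
    (∃ (M : Type) (_ : TopologicalSpace M) (_ : T2Space M) (_ : SecondCountableTopology M)
      (_ : ConnectedSpace M) (_ : ChartedSpace (Model n) M) (_ : IsManifold 𝓘(ℝ, Model n) ∞ M)
      (K : KaehlerStructure n M) (f : M → HyperbolicSpace (2 * n + p)),
      IsIsometricImmersion K.metric f ∧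
      ∃ x : M, ∀ (ℓ : ℕ) (V : Submodule ℝ (TangentSpace 𝓘(ℝ, Model n) x)),
        K.IsComplexSubspace x V ℓ →
        ((∀ S ∈ V, S ≠ 0 → sectionalCurvature K.metric x S (K.J x S) ≤ 0) → ℓ ≤ n - p + 1) ∧
        ((∀ S ∈ V, ricci K.metric x S ≤ 0) → ℓ ≤ n - p + 1)) := by
  refine ⟨fun M _ _ _ K f hf x ↦ ?_, ?_⟩
  · obtain ⟨ℓ, V, hℓ, hV, hcurv⟩ := hf.exists_isComplexSubspace (by omega) x
    exact ⟨ℓ, V, by omega, hV, fun S hS ↦ ⟨fun _ ↦ (hcurv S hS).1, (hcurv S hS).2⟩⟩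
  · obtain ⟨κ, hne, hzero⟩ := SphereProduct.exists_curvature_card (n := n) (m := p - 1) (by omega)
    let c : Model n ≃L[ℝ] (Fin n → ℂ) := .ofFinrankEq (by
      simp [Module.finrank_pi_fintype, Complex.finrank_real_complex, mul_comm])
    obtain ⟨A⟩ := exists_linearIsometry_prod_real (E := SphereProduct.Ambient κ) (N := 2 * n + p)
      (by rw [SphereProduct.finrank_ambient, hne, Fintype.card_fin]; omega)
    refine ⟨Model n, inferInstance, inferInstance, inferInstance, inferInstance,
      chartedSpaceSelf _, inferInstance, SphereProduct.kaehlerStructure c κ,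
      SphereProduct.hyperbolicImmersion c κ A, SphereProduct.isIsometricImmersion c κ A, 0,
      fun ℓ V hV ↦ ?_⟩
    rw [show n - p + 1 = Fintype.card {i // κ i = 0} by omega]
    exact ⟨fun hK ↦ SphereProduct.le_card_of_isComplexSubspace hV fun S hS i ↦
        SphereProduct.apply_eq_zero_of_sectionalCurvature_nonpos (hK S hS),
      fun hRic ↦ SphereProduct.le_card_of_isComplexSubspace hV fun S hS i ↦
        SphereProduct.apply_eq_zero_of_ricci_nonpos (hRic S hS)⟩
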